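/- Work in $\mathbb{R}^2$, with $B_R=\{|x|<R\}$. For $\epsilon>0$ put $\phi_\epsilon(s)=\dfrac{s}{(1+s^\epsilon)^{1/\epsilon}}$ for $s>0$ and $\rho(x)=\phi_\epsilon(|x|)$ for $x\neq 0$. For a real-valued function $u$ and $k\ge 0$ write $|D^ku|^2=\sum_{|\alpha|=k}|D^\alpha u|^2$, the sum being over the multi-indices $\alpha\in\mathbb{N}^2$ of length $k$, and $D=D^1$; $C_0^\infty(\Omega)$ denotes the real-valued smooth functions with compact support contained in $\Omega$, extended by zero to $\mathbb{R}^2$. **Proposition 4.4 (Carleman estimate for $\Delta^3$).** Let $\epsilon\in(0,\tfrac15]$. Then there exist constants $\overline\tau>1$, $C>1$ and $R_1\in(0,1]$, depending only on $\epsilon$, such that $$C\int\rho^{4-2\tau}|\Delta^3u|^2\,dx\;\ge\;\tau\int\rho^{2+\epsilon-2\tau}|D\Delta^2u|^2\,dx+\sum_{k=0}^{4}\tau^{9-2k}\int\rho^{2k+5\epsilon-8-2\tau}|D^ku|^2\,dx$$ for every $\tau\ge\overline\tau$ and every $u\in C_0^\infty(B_{R_1}\setminus\{0\})$. Furthermore,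 with the same constants, $$C\int\rho^{4-2\tau}|\Delta^3u|^2\,dx\;\ge\;\tau\int\rho^{2+\epsilon-2\tau}|D\Delta^2u|^2\,dx+\sum_{k=0}^{4}\tau^{9-2k}\int\rho^{2k+5\epsilon-8-2\tau}|D^ku|^2\,dx+\tau^6r^3\int\rho^{-11-2\tau}u^2\,dx$$ for every $\tau\ge\overline\tau$, every $r\in(0,R_1)$ and every $u\in C_0^\infty(B_{R_1}\setminus\overline{B}_{r/4})$. -/

import Mathlib

open MeasureTheory
open scoped Laplacian ContDiff

noncomputable section

/-- The Euclidean plane, with its Euclidean norm and Lebesgue measure. -/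
abbrev Plane : Type := EuclideanSpace ℝ (Fin 2)

/-- The profile `φ_ε(s) = s / (1 + s^ε)^(1/ε)`. -/
def phiWeight (ε s : ℝ) : ℝ := s / (1 + s ^ ε) ^ (1 / ε)

/-- The radial weight `ρ(x) = φ_ε(|x|)`. -/
def rhoWeight (ε : ℝ) (x : Plane) : ℝ := phiWeight ε ‖x‖

/-- The partial derivative of `u` in the `i`-th coordinate direction. -/
def partialDeriv (i : Fin 2) (u : Plane → ℝ) : Plane → ℝ :=
  fun x => fderiv ℝ u x (EuclideanSpace.single i 1)

/-- The derivative `D^α u` for the multi-index `α = (α₁, α₂)`. -/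
def multiDeriv (α : ℕ × ℕ) (u : Plane → ℝ) : Plane → ℝ :=
  (partialDeriv 0)^[α.1] ((partialDeriv 1)^[α.2] u)

/-- The pointwise quantity `|D^k u|² = ∑_{|α| = k} |D^α u|²`, the sum being over all
multi-indices of length `k`. -/
def normSqD (k : ℕ) (u : Plane → ℝ) (x : Plane) : ℝ :=
  ∑ α ∈ Finset.HasAntidiagonal.antidiagonal k, |multiDeriv α u x| ^ 2

/-- `u ∈ C_0^∞(Ω)`: `u` is smooth and its support is a compact subset of `Ω`. A function of
this class is regarded as defined on the whole plane, vanishing outside `Ω`. -/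
structure IsTestFunction (Ω : Set Plane) (u : Plane → ℝ) : Prop where
  contDiff : ContDiff ℝ ∞ u
  hasCompactSupport : HasCompactSupport u
  tsupport_subset : tsupport u ⊆ Ω

/-- The left member `∫ ρ^(4-2τ) |Δ³u|² dx`. -/
def carlemanSource (ε τ : ℝ) (u : Plane → ℝ) : ℝ :=
  ∫ x, rhoWeight ε x ^ (4 - 2 * τ) * |Δ (Δ (Δ u)) x| ^ 2

/-- `τ ∫ ρ^(2+ε-2τ) |DΔ²u|² dx + ∑_{k=0}^{4} τ^(9-2k) ∫ ρ^(2k+5ε-8-2τ) |D^k u|² dx`.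
The exponents `9 - 2k` are natural numbers, as `k ≤ 4`. -/
def carlemanControl (ε τ : ℝ) (u : Plane → ℝ) : ℝ :=
  τ * (∫ x, rhoWeight ε x ^ (2 + ε - 2 * τ) * normSqD 1 (Δ (Δ u)) x) +
    ∑ k ∈ Finset.range 5, τ ^ (9 - 2 * k) *
      ∫ x, rhoWeight ε x ^ (2 * (k : ℝ) + 5 * ε - 8 - 2 * τ) * normSqD k u x

end

/-! # A Carleman estimate for the cube of the Laplacian in the plane

The estimate is iterated from three inequalities for powers of the radial weight: a Hörmander
inequality for the div-curl system, which bounds the gradient of a real function by its Laplacian,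
a Hardy inequality, and an elliptic bound of second derivatives by the Laplacian. -/

/-! ### Partial derivatives and test functions on the punctured plane -/

/-! The estimate is a descent from `Δ³u` to `u`, one order of differentiation at a time, in which
two weighted inequalities alternate.

From `Δv` to `Dv`: put `f = ∂₀v - i∂₁v`, so that `(∂₀ + i∂₁)f = Δv`. In `L²(e^{2φ})` the squared
norm of `(∂₀ + i∂₁)f` is that of the adjoint applied to `f` plus the commutator term `∫ e^{2φ} 2Δφ
|f|²`; dropping the adjoint term leaves `∫ e^{2φ} 2Δφ |Dv|² ≤ ∫ e^{2φ} (Δv)²`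
(`integral_exp_mul_laplacian_mul_gradient_sq_le`). For `e^{2φ} = ρ^(a-2τ)` the part of `φ` in `log
|x|` is harmonic, and convexity comes only from the correction `log (1 + |x|^ε)` in `log ρ`. Hence
`Δφ` is of size `τ ρ^(ε-2)`: a factor `τ` is gained and a power `ρ^ε` is lost.

From `Dv` to `v`: a Hardy inequality gains `τ² ρ^(-2)` (`weightedIntegral_sq_le_gradSq`).

Three rounds give the powers `τ, τ³, τ⁴, τ⁶, τ⁷, τ⁹` and a total loss of `ρ^(3ε)`; since `ρ ≤ 1`,
this is stronger than the required `ρ^(5ε)`. The chain meets only `u`, `Du` and Laplacians. The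
remaining derivatives of order two to four follow from `weightedIntegral_hessSq_le`, which rests on
the determinant of the Hessian being a divergence, applied to `u`, its derivatives and `Δu`.

Away from the disc of radius `r / 4` the phase may be increased by `r / |x|`: its Laplacian is `r /
|x|³`, while `e^{2r/|x|}` stays between `1` and `e⁸`. The gradient step then gains `r ρ^(-3)`, and
three rounds gain `r³ τ⁶ ρ^(-15)`, which is the additional term. -/

theorem partialDeriv_mul {i : Fin 2} {f g : Plane → ℝ} {x : Plane}
    (hf : DifferentiableAt ℝ f x) (hg : DifferentiableAt ℝ g x) :
    partialDeriv i (fun y => f y * g y) x = partialDeriv i f x * g x + f x * partialDeriv i g x := by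
  simp only [partialDeriv]
  rw [fderiv_fun_mul hf hg]
  simp
  ring

theorem partialDeriv_add {i : Fin 2} {f g : Plane → ℝ} {x : Plane}
    (hf : DifferentiableAt ℝ f x) (hg : DifferentiableAt ℝ g x) :
    partialDeriv i (fun y => f y + g y) x = partialDeriv i f x + partialDeriv i g x := by
  simp only [partialDeriv]
  rw [fderiv_fun_add hf hg]
  simp

theorem partialDeriv_sub {i : Fin 2} {f g : Plane → ℝ} {x : Plane}
    (hf : DifferentiableAt ℝ f x) (hg : DifferentiableAt ℝ g x) :
    partialDeriv i (fun y => f y - g y) x = partialDeriv i f x - partialDeriv i g x := by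
  simp only [partialDeriv]
  rw [fderiv_fun_sub hf hg]
  simp

theorem partialDeriv_const_mul {i : Fin 2} {f : Plane → ℝ} {x : Plane} (c : ℝ)
    (hf : DifferentiableAt ℝ f x) :
    partialDeriv i (fun y => c * f y) x = c * partialDeriv i f x := by
  simp only [partialDeriv]
  rw [fderiv_const_mul hf]
  simp

theorem partialDeriv_comp {i : Fin 2} {f : Plane → ℝ} {h : ℝ → ℝ} {h' : ℝ} {x : Plane}
    (hh : HasDerivAt h h' (f x)) (hf : DifferentiableAt ℝ f x) :
    partialDeriv i (fun y => h (f y)) x = h' * partialDeriv i f x := by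
  have := hh.comp_hasFDerivAt x hf.hasFDerivAt
  simp only [partialDeriv]
  rw [show (fun y => h (f y)) = h ∘ f from rfl, this.fderiv]
  simp

theorem partialDeriv_congr {i : Fin 2} {f g : Plane → ℝ} {x : Plane}
    (h : f =ᶠ[nhds x] g) : partialDeriv i f x = partialDeriv i g x := by
  simp only [partialDeriv, h.fderiv_eq]

theorem ContDiff.partialDeriv {i : Fin 2} {f : Plane → ℝ} (hf : ContDiff ℝ ∞ f) :
    ContDiff ℝ ∞ (partialDeriv i f) :=
  (hf.fderiv_right (m := ∞) (by norm_num)).clm_apply contDiff_const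

theorem isOpen_punctured : IsOpen ({0}ᶜ : Set Plane) := isOpen_compl_singleton

theorem ContDiffOn.partialDeriv {i : Fin 2} {f : Plane → ℝ} (hf : ContDiffOn ℝ ∞ f {0}ᶜ) :
    ContDiffOn ℝ ∞ (partialDeriv i f) {0}ᶜ :=
  (hf.fderiv_of_isOpen (m := ∞) isOpen_punctured (by norm_num)).clm_apply contDiffOn_const

theorem ContDiffOn.differentiableAt_punctured {f : Plane → ℝ} (hf : ContDiffOn ℝ ∞ f {0}ᶜ)
    {x : Plane} (hx : x ≠ 0) : DifferentiableAt ℝ f x :=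
  (hf.contDiffAt (isOpen_punctured.mem_nhds hx)).differentiableAt (by norm_num)

theorem partialDeriv_comm {f : Plane → ℝ} (hf : ContDiff ℝ ∞ f) (i j : Fin 2) :
    partialDeriv i (partialDeriv j f) = partialDeriv j (partialDeriv i f) := by
  have h (i j : Fin 2) (x : Plane) : partialDeriv i (partialDeriv j f) x =
      fderiv ℝ (fderiv ℝ f) x (EuclideanSpace.single i 1) (EuclideanSpace.single j 1) := by
    have hd : DifferentiableAt ℝ (fderiv ℝ f) x :=
      (hf.fderiv_right (m := ∞) (by norm_num)).differentiable (by norm_num) x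
    unfold partialDeriv
    rw [fderiv_clm_apply hd (by fun_prop)]
    simp
  funext x
  rw [h, h]
  exact (hf.contDiffAt.isSymmSndFDerivAt
    (by simpa using WithTop.coe_le_coe.2 (le_top : (2 : ℕ∞) ≤ ⊤))) _ _

theorem laplacian_eq_partialDeriv {f : Plane → ℝ} (hf : ContDiff ℝ ∞ f) :
    Δ f = fun x => partialDeriv 0 (partialDeriv 0 f) x + partialDeriv 1 (partialDeriv 1 f) x := by
  rw [InnerProductSpace.laplacian_eq_iteratedFDeriv_orthonormalBasis f
    (EuclideanSpace.basisFun (Fin 2) ℝ)]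
  have h (i : Fin 2) (x : Plane) : partialDeriv i (partialDeriv i f) x =
      fderiv ℝ (fderiv ℝ f) x (EuclideanSpace.single i 1) (EuclideanSpace.single i 1) := by
    have hd : DifferentiableAt ℝ (fderiv ℝ f) x :=
      (hf.fderiv_right (m := ∞) (by norm_num)).differentiable (by norm_num) x
    unfold partialDeriv
    rw [fderiv_clm_apply hd (by fun_prop)]
    simp
  funext x
  simp [iteratedFDeriv_two_apply, h]

namespace IsTestFunction

variable {Ω : Set Plane} {f g : Plane → ℝ}

theorem mono {Ω' : Set Plane} (hf : IsTestFunction Ω f) (h : Ω ⊆ Ω') : IsTestFunction Ω' f :=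
  ⟨hf.contDiff, hf.hasCompactSupport, hf.tsupport_subset.trans h⟩

theorem differentiableAt (hf : IsTestFunction Ω f) (x : Plane) : DifferentiableAt ℝ f x :=
  hf.contDiff.differentiable (by norm_num) x

theorem of_tsupport (hf : IsTestFunction Ω f) (hg : ContDiff ℝ ∞ g) (h : tsupport g ⊆ tsupport f) :
    IsTestFunction Ω g :=
  ⟨hg, hf.hasCompactSupport.of_isClosed_subset (isClosed_tsupport g) h, h.trans hf.tsupport_subset⟩

theorem eq_zero (hf : IsTestFunction Ω f) {x : Plane} (hx : x ∉ Ω) : f x = 0 :=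
  image_eq_zero_of_notMem_tsupport fun h => hx (hf.tsupport_subset h)

theorem partialDeriv (hf : IsTestFunction Ω f) (i : Fin 2) : IsTestFunction Ω (partialDeriv i f) :=
  hf.of_tsupport hf.contDiff.partialDeriv (tsupport_fderiv_apply_subset ℝ _)

theorem add (hf : IsTestFunction Ω f) (hg : IsTestFunction Ω g) :
    IsTestFunction Ω (fun x => f x + g x) :=
  ⟨hf.contDiff.add hg.contDiff, hf.hasCompactSupport.add hg.hasCompactSupport,
    (tsupport_add f g).trans (Set.union_subset hf.tsupport_subset hg.tsupport_subset)⟩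

theorem sub (hf : IsTestFunction Ω f) (hg : IsTestFunction Ω g) :
    IsTestFunction Ω (fun x => f x - g x) :=
  ⟨hf.contDiff.sub hg.contDiff, hf.hasCompactSupport.sub hg.hasCompactSupport,
    (tsupport_sub f g).trans (Set.union_subset hf.tsupport_subset hg.tsupport_subset)⟩

theorem mul (hf : IsTestFunction Ω f) (hg : IsTestFunction Ω g) :
    IsTestFunction Ω (fun x => f x * g x) :=
  hf.of_tsupport (hf.contDiff.mul hg.contDiff) tsupport_mul_subset_left

theorem sq (hf : IsTestFunction Ω f) : IsTestFunction Ω (fun x => f x ^ 2) := by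
  simpa only [pow_two] using hf.mul hf

theorem laplacian (hf : IsTestFunction Ω f) : IsTestFunction Ω (Δ f) := by
  rw [laplacian_eq_partialDeriv hf.contDiff]
  exact ((hf.partialDeriv 0).partialDeriv 0).add ((hf.partialDeriv 1).partialDeriv 1)

theorem partialDeriv_laplacian (hf : IsTestFunction Ω f) (i : Fin 2) :
    _root_.partialDeriv i (Δ f) = Δ (_root_.partialDeriv i f) := by
  have h := hf.partialDeriv
  rw [laplacian_eq_partialDeriv hf.contDiff, laplacian_eq_partialDeriv (h i).contDiff]
  funext x
  rw [partialDeriv_add (((h 0).partialDeriv 0).differentiableAt x)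
    (((h 1).partialDeriv 1).differentiableAt x), partialDeriv_comm (h 0).contDiff i 0,
    partialDeriv_comm (h 1).contDiff i 1, partialDeriv_comm hf.contDiff i 0,
    partialDeriv_comm hf.contDiff i 1]

/-- The support is compact and misses the origin, so the singularity of the weight there is
harmless. -/
theorem weight_mul {w : Plane → ℝ} (hf : IsTestFunction {0}ᶜ f) (hw : ContDiffOn ℝ ∞ w {0}ᶜ) :
    IsTestFunction {0}ᶜ (fun x => w x * f x) := by
  refine hf.of_tsupport ?_ tsupport_mul_subset_right
  refine contDiff_iff_contDiffAt.2 fun x => ?_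
  by_cases hx : x = 0
  · have h0 : x ∉ tsupport f := fun h => hf.tsupport_subset h hx
    have : (fun x => w x * f x) =ᶠ[nhds x] fun _ => 0 := by
      filter_upwards [notMem_tsupport_iff_eventuallyEq.1 h0] with y hy
      simp [hy]
    exact contDiffAt_const.congr_of_eventuallyEq this
  · exact (hw.contDiffAt (isOpen_punctured.mem_nhds hx)).mul hf.contDiff.contDiffAt

theorem integrable (hf : IsTestFunction Ω f) : Integrable f :=
  hf.contDiff.continuous.integrable_of_hasCompactSupport hf.hasCompactSupport

theorem integrable_weight_mul {w : Plane → ℝ} (hf : IsTestFunction {0}ᶜ f)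
    (hw : ContDiffOn ℝ ∞ w {0}ᶜ) : Integrable (fun x => w x * f x) :=
  (hf.weight_mul hw).integrable

theorem integral_partialDeriv (hf : IsTestFunction Ω f) (i : Fin 2) :
    ∫ x, _root_.partialDeriv i f x = 0 := by
  -- Integration by parts against the constant `1`.
  have := integral_mul_fderiv_eq_neg_fderiv_mul_of_integrable (μ := (volume : Measure Plane))
    (f := fun _ => (1 : ℝ)) (g := f) (v := EuclideanSpace.single i 1)
    (by simp)
    (by simp only [one_mul]; exact (hf.partialDeriv i).integrable) (by simpa using hf.integrable)
    (fun x _ => by fun_prop) (fun x _ => hf.differentiableAt x)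
  simpa [_root_.partialDeriv] using this

theorem partialDeriv_weight_mul {w : Plane → ℝ} (hf : IsTestFunction {0}ᶜ f)
    (hw : ContDiffOn ℝ ∞ w {0}ᶜ) (i : Fin 2) {x : Plane} (hx : x ≠ 0) :
    _root_.partialDeriv i (fun x => w x * f x) x =
      _root_.partialDeriv i w x * f x + w x * _root_.partialDeriv i f x :=
  partialDeriv_mul (hw.differentiableAt_punctured hx) (hf.differentiableAt x)

end IsTestFunction

theorem ae_ne_zero_plane : ∀ᵐ x : Plane, x ≠ 0 := by
  simp [ae_iff]

/-! ### Three weighted integral inequalities -/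

/-- The partial derivative of a weighted test function is integrable, with vanishing integral. -/
theorem integrable_partialDeriv_weight_mul {w f : Plane → ℝ} (hw : ContDiffOn ℝ ∞ w {0}ᶜ)
    (hf : IsTestFunction {0}ᶜ f) (i : Fin 2) :
    Integrable (partialDeriv i fun x => w x * f x) ∧
      ∫ x, partialDeriv i (fun x => w x * f x) x = 0 :=
  ⟨((hf.weight_mul hw).partialDeriv i).integrable, (hf.weight_mul hw).integral_partialDeriv i⟩

/-- The Hörmander inequality for the div-curl system. -/
theorem integral_exp_mul_laplacian_mul_sq_le {φ p q : Plane → ℝ} (hφ : ContDiffOn ℝ ∞ φ {0}ᶜ)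
    (hp : IsTestFunction {0}ᶜ p) (hq : IsTestFunction {0}ᶜ q) :
    ∫ x, (Real.exp (2 * φ x) * (partialDeriv 0 (partialDeriv 0 φ) x +
        partialDeriv 1 (partialDeriv 1 φ) x)) * (2 * (p x ^ 2 + q x ^ 2)) ≤
      ∫ x, Real.exp (2 * φ x) * ((partialDeriv 0 p x + partialDeriv 1 q x) ^ 2 +
        (partialDeriv 1 p x - partialDeriv 0 q x) ^ 2) := by
  have ha := hφ.partialDeriv (i := 0)
  have hb := hφ.partialDeriv (i := 1)
  have hW : ContDiffOn ℝ ∞ (fun x => Real.exp (2 * φ x)) {0}ᶜ :=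
    (contDiffOn_const.mul hφ).exp
  have hdW (i : Fin 2) {x : Plane} (hx : x ≠ 0) : partialDeriv i (fun x => Real.exp (2 * φ x)) x =
      2 * partialDeriv i φ x * Real.exp (2 * φ x) := by
    have hd := hφ.differentiableAt_punctured hx
    rw [partialDeriv_comp (h := Real.exp) (Real.hasDerivAt_exp _) (hd.const_mul 2),
      partialDeriv_const_mul 2 hd]
    ring
  have hV : IsTestFunction {0}ᶜ (fun x => p x * p x + q x * q x) := (hp.mul hp).add (hq.mul hq)
  have hpx := hp.partialDeriv
  have hqx := hq.partialDeriv
  have hJ (i : Fin 2) : IsTestFunction {0}ᶜ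
      (fun x => p x * partialDeriv i q x - q x * partialDeriv i p x) :=
    (hp.mul (hqx i)).sub (hq.mul (hpx i))
  have hWa (i : Fin 2) : ContDiffOn ℝ ∞ (fun x => Real.exp (2 * φ x) * partialDeriv i φ x) {0}ᶜ :=
    hW.mul hφ.partialDeriv
  have e1 := integrable_partialDeriv_weight_mul (hWa 0) hV 0
  have e2 := integrable_partialDeriv_weight_mul (hWa 1) hV 1
  have e3 := integrable_partialDeriv_weight_mul hW (hJ 1) 0
  have e4 := integrable_partialDeriv_weight_mul hW (hJ 0) 1
  have hdV (i : Fin 2) (x : Plane) : partialDeriv i (fun x => p x * p x + q x * q x) x =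
      2 * (p x * partialDeriv i p x + q x * partialDeriv i q x) := by
    rw [partialDeriv_add ((hp.mul hp).differentiableAt x) ((hq.mul hq).differentiableAt x),
      partialDeriv_mul (hp.differentiableAt x) (hp.differentiableAt x),
      partialDeriv_mul (hq.differentiableAt x) (hq.differentiableAt x)]
    ring
  have hdJ (i j : Fin 2) (x : Plane) :
      partialDeriv i (fun x => p x * partialDeriv j q x - q x * partialDeriv j p x) x =
      partialDeriv i p x * partialDeriv j q x - partialDeriv i q x * partialDeriv j p x +
        (p x * partialDeriv i (partialDeriv j q) x - q x * partialDeriv i (partialDeriv j p) x) := by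
    rw [partialDeriv_sub ((hp.mul (hqx j)).differentiableAt x)
        ((hq.mul (hpx j)).differentiableAt x),
      partialDeriv_mul (hp.differentiableAt x) ((hqx j).differentiableAt x),
      partialDeriv_mul (hq.differentiableAt x) ((hpx j).differentiableAt x)]
    ring
  have hcomm := fun x => congrFun (partialDeriv_comm hp.contDiff 1 0) x
  have hcomm' := fun x => congrFun (partialDeriv_comm hq.contDiff 1 0) x
  have hL : Integrable (fun x => (Real.exp (2 * φ x) * (partialDeriv 0 (partialDeriv 0 φ) x +
        partialDeriv 1 (partialDeriv 1 φ) x)) * (2 * (p x ^ 2 + q x ^ 2))) := by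
    refine (((hp.sq.add hq.sq).integrable_weight_mul
      (hW.mul ((ha.partialDeriv (i := 0)).add (hb.partialDeriv (i := 1))))).const_mul 2).congr (ae_of_all _ fun x => ?_)
    ring
  have hR : Integrable (fun x => Real.exp (2 * φ x) *
      ((partialDeriv 0 p x + partialDeriv 1 q x) ^ 2 +
        (partialDeriv 1 p x - partialDeriv 0 q x) ^ 2)) :=
    (((hpx 0).add (hqx 1)).sq.add ((hpx 1).sub (hqx 0)).sq).integrable_weight_mul hW
  -- With this combination of divergences, the right integrand minus the left one is a divergence
  -- plus a square. The first pair produces `2Δφ`; the second produces the Jacobian of `(p, q)`, the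
  -- second derivatives cancelling.
  have hD := (((e1.1.const_mul (-2)).add (e2.1.const_mul (-2))).add (e3.1.const_mul 2)).sub
    (e4.1.const_mul 2)
  have h0 := integral_mono_ae hD (hR.sub hL) ?_
  · rw [integral_sub' hR hL, integral_sub' (((e1.1.const_mul (-2)).add (e2.1.const_mul (-2))).add
      (e3.1.const_mul 2)) (e4.1.const_mul 2), integral_add' ((e1.1.const_mul (-2)).add
      (e2.1.const_mul (-2))) (e3.1.const_mul 2), integral_add' (e1.1.const_mul (-2))
      (e2.1.const_mul (-2))] at h0
    simp only [integral_const_mul, e1.2, e2.2, e3.2, e4.2] at h0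
    linarith
  · filter_upwards [ae_ne_zero_plane] with x hx
    simp only [Pi.add_apply, Pi.sub_apply]
    rw [hV.partialDeriv_weight_mul (hWa 0) 0 hx, hV.partialDeriv_weight_mul (hWa 1) 1 hx,
      (hJ 1).partialDeriv_weight_mul hW 0 hx, (hJ 0).partialDeriv_weight_mul hW 1 hx,
      partialDeriv_mul (hW.differentiableAt_punctured hx) (ha.differentiableAt_punctured hx),
      partialDeriv_mul (hW.differentiableAt_punctured hx) (hb.differentiableAt_punctured hx),
      hdW 0 hx, hdW 1 hx, hdV, hdV, hdJ, hdJ, hcomm, hcomm', ← sub_nonneg]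
    -- For `f = p - iq` this is `e^{2φ}` times the squared modulus of `e^{-2φ} (∂₀ - i∂₁)(e^{2φ}
    -- f)`, the adjoint term.
    have hsq : 0 ≤ Real.exp (2 * φ x) *
        ((partialDeriv 0 p x - partialDeriv 1 q x +
            2 * (partialDeriv 0 φ x * p x - partialDeriv 1 φ x * q x)) ^ 2 +
          (partialDeriv 0 q x + partialDeriv 1 p x +
            2 * (partialDeriv 0 φ x * q x + partialDeriv 1 φ x * p x)) ^ 2) := by positivity
    refine hsq.trans_eq ?_
    ring

/-- The Hörmander inequality for gradients. -/
theorem integral_exp_mul_laplacian_mul_gradient_sq_le {φ u : Plane → ℝ}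
    (hφ : ContDiffOn ℝ ∞ φ {0}ᶜ) (hu : IsTestFunction {0}ᶜ u) :
    ∫ x, (Real.exp (2 * φ x) * (partialDeriv 0 (partialDeriv 0 φ) x +
        partialDeriv 1 (partialDeriv 1 φ) x)) *
          (2 * (partialDeriv 0 u x ^ 2 + partialDeriv 1 u x ^ 2)) ≤
      ∫ x, Real.exp (2 * φ x) * (Δ u) x ^ 2 := by
  -- A gradient has divergence `Δu` and no curl.
  refine (integral_exp_mul_laplacian_mul_sq_le hφ (hu.partialDeriv 0) (hu.partialDeriv 1)).trans_eq
    (integral_congr_ae (ae_of_all _ fun x => ?_))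
  simp [laplacian_eq_partialDeriv hu.contDiff, partialDeriv_comm hu.contDiff 1 0]

/-- A weighted Hardy inequality, for the vector field `(m₀, m₁)` and weight `w`. -/
theorem integral_divergence_mul_sq_le {m n w u : Plane → ℝ} (hm : ContDiffOn ℝ ∞ m {0}ᶜ)
    (hn : ContDiffOn ℝ ∞ n {0}ᶜ) (hw : ContDiffOn ℝ ∞ w {0}ᶜ) (hu : IsTestFunction {0}ᶜ u)
    {v : Plane → ℝ} (hv : ContDiffOn ℝ ∞ v {0}ᶜ)
    (h : ∀ x ∈ tsupport u, v x * u x ^ 2 - w x * (partialDeriv 0 u x ^ 2 + partialDeriv 1 u x ^ 2) ≤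
      (partialDeriv 0 m x + partialDeriv 1 n x) * u x ^ 2 +
        2 * u x * (m x * partialDeriv 0 u x + n x * partialDeriv 1 u x)) :
    ∫ x, v x * u x ^ 2 ≤
      ∫ x, w x * (partialDeriv 0 u x ^ 2 + partialDeriv 1 u x ^ 2) := by
  have hU : IsTestFunction {0}ᶜ (fun x => u x * u x) := hu.mul hu
  have e1 := integrable_partialDeriv_weight_mul hm hU 0
  have e2 := integrable_partialDeriv_weight_mul hn hU 1
  have hL := hu.sq.integrable_weight_mul hv
  have hR := ((hu.partialDeriv 0).sq.add (hu.partialDeriv 1).sq).integrable_weight_mul hw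
  have h0 := integral_mono_ae (hL.sub hR) (e1.1.add e2.1) ?_
  · rw [integral_sub' hL hR, integral_add' e1.1 e2.1, e1.2, e2.2] at h0
    linarith
  · filter_upwards [ae_ne_zero_plane] with x hx
    simp only [Pi.add_apply, Pi.sub_apply]
    rw [hU.partialDeriv_weight_mul hm 0 hx, hU.partialDeriv_weight_mul hn 1 hx,
      partialDeriv_mul (hu.differentiableAt x) (hu.differentiableAt x),
      partialDeriv_mul (hu.differentiableAt x) (hu.differentiableAt x)]
    by_cases hxu : x ∈ tsupport u
    · exact (h x hxu).trans_eq (by ring)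
    · have h1 (i : Fin 2) : partialDeriv i u x = 0 :=
        image_eq_zero_of_notMem_tsupport fun h' => hxu (tsupport_fderiv_apply_subset ℝ _ h')
      simp [h1, image_eq_zero_of_notMem_tsupport hxu]

/-- Weighted second derivatives are controlled by the Laplacian and the gradient. -/
theorem integral_weight_mul_hessian_sq_le {w v u : Plane → ℝ} (hw : ContDiffOn ℝ ∞ w {0}ᶜ)
    (hv : ContDiffOn ℝ ∞ v {0}ᶜ) (hu : IsTestFunction {0}ᶜ u)
    (hwpos : ∀ x ∈ tsupport u, 0 < w x)
    (hwv : ∀ x ∈ tsupport u, ∀ i, partialDeriv i w x ^ 2 ≤ v x * w x) :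
    ∫ x, w x * (partialDeriv 0 (partialDeriv 0 u) x ^ 2 + partialDeriv 0 (partialDeriv 1 u) x ^ 2 +
        partialDeriv 1 (partialDeriv 1 u) x ^ 2) ≤
      2 * (∫ x, w x * (Δ u) x ^ 2) +
        8 * ∫ x, v x * (partialDeriv 0 u x ^ 2 + partialDeriv 1 u x ^ 2) := by
  have hx := hu.partialDeriv
  have hxx := fun i j => (hx i).partialDeriv j
  have hF : IsTestFunction {0}ᶜ
      (fun x => partialDeriv 0 u x * partialDeriv 1 (partialDeriv 1 u) x) := (hx 0).mul (hxx 1 1)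
  have hG : IsTestFunction {0}ᶜ
      (fun x => partialDeriv 0 u x * partialDeriv 0 (partialDeriv 1 u) x) := (hx 0).mul (hxx 1 0)
  have e1 := integrable_partialDeriv_weight_mul hw hF 0
  have e2 := integrable_partialDeriv_weight_mul hw hG 1
  have hH := (((hxx 0 0).sq.add (hxx 1 0).sq).add (hxx 1 1).sq).integrable_weight_mul hw
  have hL := (hu.laplacian.sq.integrable_weight_mul hw).const_mul 2
  have hV := (((hx 0).sq.add (hx 1).sq).integrable_weight_mul hv).const_mul 8
  -- Without derivatives of `w`, the added divergence is `4w` times the determinant `u₀₀u₁₁ - u₀₁²`: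
  -- third derivatives cancel. The trace identity `2(Δu)² = 2u₀₀² + 4u₀₀u₁₁ + 2u₁₁²` then leaves `w
  -- (u₀₀² + 3u₀₁² + u₁₁²)` to absorb the terms with `Dw`.
  have h0 := integral_mono_ae (hH.add ((e1.1.const_mul 4).sub (e2.1.const_mul 4)))
    (hL.add hV) ?_
  · rw [integral_add' hL hV, integral_add' hH ((e1.1.const_mul 4).sub (e2.1.const_mul 4)),
      integral_sub' (e1.1.const_mul 4) (e2.1.const_mul 4)] at h0
    simp only [integral_const_mul, e1.2, e2.2] at h0
    linarith
  · filter_upwards [ae_ne_zero_plane] with x hx0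
    simp only [Pi.add_apply, Pi.sub_apply]
    rw [hF.partialDeriv_weight_mul hw 0 hx0, hG.partialDeriv_weight_mul hw 1 hx0,
      partialDeriv_mul ((hx 0).differentiableAt x) ((hxx 1 1).differentiableAt x),
      partialDeriv_mul ((hx 0).differentiableAt x) ((hxx 1 0).differentiableAt x),
      partialDeriv_comm (hx 1).contDiff 1 0, laplacian_eq_partialDeriv hu.contDiff,
      partialDeriv_comm hu.contDiff 1 0]
    beta_reduce
    by_cases hxu : x ∈ tsupport u
    · have hw0 := hwpos x hxu
      have h1 := hwv x hxu 0
      have h2 := hwv x hxu 1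
      generalize partialDeriv 0 (partialDeriv 0 u) x = r
      generalize partialDeriv 0 (partialDeriv 1 u) x = s
      generalize partialDeriv 1 (partialDeriv 1 u) x = t
      generalize partialDeriv 0 u x = p
      generalize partialDeriv 1 u x = q
      generalize partialDeriv 0 (partialDeriv 1 (partialDeriv 1 u)) x = z
      generalize partialDeriv 0 w x = a at *
      generalize partialDeriv 1 w x = b at *
      generalize w x = W at *
      generalize v x = V at *
      -- Young's inequality for the terms in which the weight is differentiated.
      have key (a y : ℝ) (h : a ^ 2 ≤ V * W) : -(4 * a * p * y) ≤ W * y ^ 2 + 4 * V * p ^ 2 := by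
        have : 0 ≤ (W * y + 2 * a * p) ^ 2 / W := by positivity
        have h3 : (W * y + 2 * a * p) ^ 2 / W =
            W * y ^ 2 + 4 * a * p * y + 4 * p ^ 2 * (a ^ 2 / W) := by
          field_simp; ring
        have h4 : a ^ 2 / W ≤ V := (div_le_iff₀ hw0).2 h
        nlinarith [mul_le_mul_of_nonneg_left h4 (by positivity : 0 ≤ 4 * p ^ 2)]
      have k1 := key (-a) t (by simpa using h1)
      have k2 := key b s h2
      have hV0 : 0 ≤ V := nonneg_of_mul_nonneg_left ((sq_nonneg a).trans h1) hw0
      nlinarith [mul_nonneg hw0.le (sq_nonneg r), mul_nonneg hw0.le (sq_nonneg s),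
        mul_nonneg hw0.le (sq_nonneg t), mul_nonneg hV0 (sq_nonneg q)]
    · have h1 (i : Fin 2) : partialDeriv i u x = 0 :=
        image_eq_zero_of_notMem_tsupport fun h' => hxu (tsupport_fderiv_apply_subset ℝ _ h')
      have h2 (i j : Fin 2) : partialDeriv i (partialDeriv j u) x = 0 :=
        image_eq_zero_of_notMem_tsupport fun h' => hxu (tsupport_fderiv_apply_subset ℝ _
          (tsupport_fderiv_apply_subset ℝ _ h'))
      simp [h1, h2]

/-! ### The radial weight -/

theorem contDiffOn_norm_punctured : ContDiffOn ℝ ∞ (fun x : Plane => ‖x‖) {0}ᶜ :=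
  fun _ hx => (contDiffAt_norm ℝ hx).contDiffWithinAt

theorem norm_sq_plane (x : Plane) : ‖x‖ ^ 2 = x 0 ^ 2 + x 1 ^ 2 := by
  simp [EuclideanSpace.norm_sq_eq]

theorem partialDeriv_coord (i j : Fin 2) (x : Plane) :
    partialDeriv i (fun y : Plane => y j) x = if i = j then 1 else 0 := by
  have h : HasFDerivAt (fun y : Plane => y j) (EuclideanSpace.proj j : Plane →L[ℝ] ℝ) x :=
    (EuclideanSpace.proj j : Plane →L[ℝ] ℝ).hasFDerivAt
  rw [partialDeriv, h.fderiv]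
  simp [eq_comm]

theorem differentiableAt_coord (j : Fin 2) (x : Plane) :
    DifferentiableAt ℝ (fun y : Plane => y j) x :=
  (EuclideanSpace.proj j : Plane →L[ℝ] ℝ).differentiableAt

theorem partialDeriv_norm {i : Fin 2} {x : Plane} (hx : x ≠ 0) :
    partialDeriv i (fun y : Plane => ‖y‖) x = x i / ‖x‖ := by
  have hn : 0 < ‖x‖ := norm_pos_iff.2 hx
  have hd := contDiffOn_norm_punctured.differentiableAt_punctured hx
  have h1 : partialDeriv i (fun y : Plane => ‖y‖ * ‖y‖) x = 2 * x i := by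
    have : (fun y : Plane => ‖y‖ * ‖y‖) = fun y : Plane => y 0 * y 0 + y 1 * y 1 := by
      funext y; linarith [norm_sq_plane y]
    have h (j : Fin 2) := differentiableAt_coord j x
    rw [this, partialDeriv_add ((h 0).fun_mul (h 0)) ((h 1).fun_mul (h 1)), partialDeriv_mul (h 0) (h 0),
      partialDeriv_mul (h 1) (h 1), partialDeriv_coord, partialDeriv_coord]
    fin_cases i <;> simp <;> ring
  rw [partialDeriv_mul hd hd] at h1
  field_simp
  linarith

/-- The divergence of a radial field `k(|x|) x`. -/
theorem divergence_radial {f : Plane → ℝ} {k : ℝ → ℝ} {k' : ℝ}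
    {x : Plane} (hx : x ≠ 0) (hk : HasDerivAt k k' ‖x‖)
    (hf : ∀ y : Plane, y ≠ 0 → ∀ i, partialDeriv i f y = y i * k ‖y‖) :
    partialDeriv 0 (partialDeriv 0 f) x + partialDeriv 1 (partialDeriv 1 f) x =
      2 * k ‖x‖ + ‖x‖ * k' := by
  have hn : 0 < ‖x‖ := norm_pos_iff.2 hx
  have hd := contDiffOn_norm_punctured.differentiableAt_punctured hx
  have hkd : DifferentiableAt ℝ (fun y : Plane => k ‖y‖) x :=
    hk.differentiableAt.comp (g := k) x hd
  have h (i : Fin 2) : partialDeriv i (partialDeriv i f) x = k ‖x‖ + x i ^ 2 * k' / ‖x‖ := by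
    have he : partialDeriv i f =ᶠ[nhds x] fun y => y i * k ‖y‖ := by
      filter_upwards [isOpen_punctured.mem_nhds hx] with y hy using hf y hy i
    rw [partialDeriv_congr he, partialDeriv_mul (differentiableAt_coord i x) hkd,
      partialDeriv_coord, partialDeriv_comp hk hd, partialDeriv_norm hx]
    simp only [if_true]
    ring
  rw [h, h]
  have := norm_sq_plane x
  field_simp
  linear_combination (-k') * this

section weight

variable {ε : ℝ} {x : Plane}

theorem rhoWeight_pos (hx : x ≠ 0) : 0 < rhoWeight ε x := by
  have hn : 0 < ‖x‖ := norm_pos_iff.2 hx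
  unfold rhoWeight phiWeight
  positivity

theorem rhoWeight_le_norm (hε : 0 < ε) : rhoWeight ε x ≤ ‖x‖ := by
  unfold rhoWeight phiWeight
  have h : 1 ≤ (1 + ‖x‖ ^ ε) ^ (1 / ε) :=
    Real.one_le_rpow (by linarith [Real.rpow_nonneg (norm_nonneg x) ε]) (by positivity)
  exact div_le_self (norm_nonneg x) h

/-- On the unit disc `1 + |x|^ε ≤ 2`. Together with `rhoWeight_le_norm` this makes `ρ` and `|x|`
comparable, so powers of `|x|` from differentiated weights can be exchanged for powers of `ρ`. -/
theorem norm_le_mul_rhoWeight (hε : 0 < ε) (hx : ‖x‖ ≤ 1) :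
    ‖x‖ ≤ 2 ^ (1 / ε) * rhoWeight ε x := by
  unfold rhoWeight phiWeight
  have h0 : 0 ≤ ‖x‖ ^ ε := Real.rpow_nonneg (norm_nonneg x) ε
  have h1 : ‖x‖ ^ ε ≤ 1 := Real.rpow_le_one (norm_nonneg x) hx hε.le
  have h2 : (1 + ‖x‖ ^ ε) ^ (1 / ε) ≤ 2 ^ (1 / ε) :=
    Real.rpow_le_rpow (by positivity) (by linarith) (by positivity)
  have h3 : 0 < (1 + ‖x‖ ^ ε) ^ (1 / ε) := by positivity
  rw [← mul_div_assoc, le_div_iff₀ h3, mul_comm]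
  exact mul_le_mul_of_nonneg_right h2 (norm_nonneg x)

theorem contDiffOn_rhoWeight : ContDiffOn ℝ ∞ (rhoWeight ε) {0}ᶜ := by
  have h1 : ContDiffOn ℝ ∞ (fun x : Plane => 1 + ‖x‖ ^ ε) {0}ᶜ :=
    contDiffOn_const.add (contDiffOn_norm_punctured.rpow_const_of_ne
      fun x hx => norm_ne_zero_iff.2 hx)
  have h2 (x : Plane) : 0 < 1 + ‖x‖ ^ ε := by positivity
  exact contDiffOn_norm_punctured.div (h1.rpow_const_of_ne fun x _ => (h2 x).ne')
    fun x _ => (Real.rpow_pos_of_pos (h2 x) _).ne'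

theorem contDiffOn_rhoWeight_rpow (a : ℝ) :
    ContDiffOn ℝ ∞ (fun x => rhoWeight ε x ^ a) {0}ᶜ :=
  contDiffOn_rhoWeight.rpow_const_of_ne fun _ hx => (rhoWeight_pos hx).ne'

theorem contDiffOn_log_rhoWeight : ContDiffOn ℝ ∞ (fun x => Real.log (rhoWeight ε x)) {0}ᶜ :=
  contDiffOn_rhoWeight.log fun _ hx => (rhoWeight_pos hx).ne'

theorem partialDeriv_log_rhoWeight (hε : 0 < ε) (hx : x ≠ 0) (i : Fin 2) :
    partialDeriv i (fun y => Real.log (rhoWeight ε y)) x = x i * (‖x‖ ^ 2 * (1 + ‖x‖ ^ ε))⁻¹ := by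
  have hn : 0 < ‖x‖ := norm_pos_iff.2 hx
  have hd := contDiffOn_norm_punctured.differentiableAt_punctured hx
  have he : (fun y : Plane => Real.log (rhoWeight ε y)) =ᶠ[nhds x]
      fun y : Plane => Real.log ‖y‖ - 1 / ε * Real.log (1 + ‖y‖ ^ ε) := by
    filter_upwards [isOpen_punctured.mem_nhds hx] with y hy
    have hy' : 0 < ‖y‖ := norm_pos_iff.2 hy
    have h1 : 0 < 1 + ‖y‖ ^ ε := by positivity
    rw [rhoWeight, phiWeight, Real.log_div hy'.ne' (by positivity), Real.log_rpow h1]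
  have hP : 0 < ‖x‖ ^ ε := by positivity
  have h : HasDerivAt (fun s : ℝ => Real.log s - 1 / ε * Real.log (1 + s ^ ε))
      (‖x‖⁻¹ - 1 / ε * ((ε * ‖x‖ ^ (ε - 1)) / (1 + ‖x‖ ^ ε))) ‖x‖ :=
    (Real.hasDerivAt_log hn.ne').sub
      ((((Real.hasDerivAt_rpow_const (Or.inl hn.ne')).const_add 1).log
        (by positivity)).const_mul (1 / ε))
  rw [partialDeriv_congr he,
    partialDeriv_comp (h := fun s : ℝ => Real.log s - 1 / ε * Real.log (1 + s ^ ε)) h hd,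
    partialDeriv_norm hx, Real.rpow_sub_one hn.ne']
  field_simp
  ring

theorem partialDeriv_rhoWeight_rpow (hε : 0 < ε) (hx : x ≠ 0) (i : Fin 2) (a : ℝ) :
    partialDeriv i (fun y => rhoWeight ε y ^ a) x =
      a * rhoWeight ε x ^ a * (x i * (‖x‖ ^ 2 * (1 + ‖x‖ ^ ε))⁻¹) := by
  have he : (fun y : Plane => rhoWeight ε y ^ a) =ᶠ[nhds x]
      fun y : Plane => Real.exp (a * Real.log (rhoWeight ε y)) := by
    filter_upwards [isOpen_punctured.mem_nhds hx] with y hy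
    rw [Real.rpow_def_of_pos (rhoWeight_pos hy), mul_comm]
  have hd := (contDiffOn_log_rhoWeight (ε := ε)).differentiableAt_punctured hx
  rw [partialDeriv_congr he, partialDeriv_comp (h := Real.exp) (Real.hasDerivAt_exp _)
    (hd.const_mul a), partialDeriv_const_mul a hd, partialDeriv_log_rhoWeight hε hx,
    Real.rpow_def_of_pos (rhoWeight_pos hx), mul_comm (Real.log _) a]
  ring

/-- The Carleman phase `-σ log ρ + r / |x|`. -/
noncomputable def carlemanPhase (ε σ r : ℝ) (x : Plane) : ℝ :=
  -σ * Real.log (rhoWeight ε x) + r * ‖x‖⁻¹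

theorem contDiffOn_carlemanPhase (σ r : ℝ) : ContDiffOn ℝ ∞ (carlemanPhase ε σ r) {0}ᶜ :=
  (contDiffOn_const.mul contDiffOn_log_rhoWeight).add
    (contDiffOn_const.mul (contDiffOn_norm_punctured.inv fun _ hx => norm_ne_zero_iff.2 hx))

theorem exp_two_mul_carlemanPhase (hx : x ≠ 0) (σ r : ℝ) :
    Real.exp (2 * carlemanPhase ε σ r x) =
      rhoWeight ε x ^ (-2 * σ) * Real.exp (2 * (r * ‖x‖⁻¹)) := by
  rw [Real.rpow_def_of_pos (rhoWeight_pos hx), ← Real.exp_add, carlemanPhase]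
  ring_nf

/-- In the plane `log |x|` is harmonic, so the first term comes from `(σ/ε) log (1 + |x|^ε)` alone.
The second is the planar identity `Δ(1/|x|) = 1/|x|³`. Both are nonnegative when `σ, r ≥ 0`. -/
theorem laplacian_carlemanPhase (hε : 0 < ε) (hx : x ≠ 0) (σ r : ℝ) :
    partialDeriv 0 (partialDeriv 0 (carlemanPhase ε σ r)) x +
        partialDeriv 1 (partialDeriv 1 (carlemanPhase ε σ r)) x =
      σ * ε * ‖x‖ ^ ε / (‖x‖ ^ 2 * (1 + ‖x‖ ^ ε) ^ 2) + r / ‖x‖ ^ 3 := by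
  have hn : 0 < ‖x‖ := norm_pos_iff.2 hx
  have hP : 0 < ‖x‖ ^ ε := by positivity
  have h1 : HasDerivAt (fun s : ℝ => s ^ 2 * (1 + s ^ ε))
      (2 * ‖x‖ * (1 + ‖x‖ ^ ε) + ‖x‖ ^ 2 * (ε * ‖x‖ ^ (ε - 1))) ‖x‖ := by
    simpa using (hasDerivAt_pow 2 ‖x‖).fun_mul
      ((Real.hasDerivAt_rpow_const (p := ε) (Or.inl hn.ne')).const_add 1)
  have h2 := (h1.fun_inv (by positivity)).const_mul (-σ)
  have h3 := ((hasDerivAt_pow 3 ‖x‖).fun_inv (by positivity)).const_mul r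
  rw [divergence_radial (k := fun s => -σ * (s ^ 2 * (1 + s ^ ε))⁻¹ - r * (s ^ 3)⁻¹) hx
    (h2.fun_sub h3)]
  · rw [Real.rpow_sub_one hn.ne']
    field_simp
    ring
  · intro y hy i
    have hy' : 0 < ‖y‖ := norm_pos_iff.2 hy
    have hd := (contDiffOn_log_rhoWeight (ε := ε)).differentiableAt_punctured hy
    have hd' := contDiffOn_norm_punctured.differentiableAt_punctured hy
    have hi : DifferentiableAt ℝ (fun z : Plane => ‖z‖⁻¹) y := hd'.inv hy'.ne'
    have e : carlemanPhase ε σ r =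
      fun z => -σ * Real.log (rhoWeight ε z) + r * ‖z‖⁻¹ := rfl
    rw [e, partialDeriv_add (hd.const_mul _) (hi.const_mul r), partialDeriv_const_mul _ hd,
      partialDeriv_const_mul r hi, partialDeriv_log_rhoWeight hε hy,
      partialDeriv_comp (h := fun s : ℝ => s⁻¹) (hasDerivAt_inv hy'.ne') hd',
      partialDeriv_norm hy]
    field_simp
    ring

end weight

/-! ### Weighted inequalities with powers of the radial weight -/

/-- The integral `∫ ρ^a f`. -/
noncomputable def weightedIntegral (ε a : ℝ) (f : Plane → ℝ) : ℝ := ∫ x, rhoWeight ε x ^ a * f x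

/-- The squared length of the gradient. -/
noncomputable def gradSq (u : Plane → ℝ) (x : Plane) : ℝ :=
  partialDeriv 0 u x ^ 2 + partialDeriv 1 u x ^ 2

/-- The sum of the squares of the second derivatives. -/
noncomputable def hessSq (u : Plane → ℝ) (x : Plane) : ℝ :=
  partialDeriv 0 (partialDeriv 0 u) x ^ 2 + partialDeriv 0 (partialDeriv 1 u) x ^ 2 +
    partialDeriv 1 (partialDeriv 1 u) x ^ 2

/-- The punctured open unit disc. -/
abbrev puncturedDisc : Set Plane := Metric.ball 0 1 \ {0}

section

variable {ε a b : ℝ} {f g u : Plane → ℝ} {x : Plane}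

theorem puncturedDisc_subset : puncturedDisc ⊆ {0}ᶜ := fun _ hx => hx.2

theorem mem_puncturedDisc : x ∈ puncturedDisc ↔ x ≠ 0 ∧ ‖x‖ < 1 := by
  simp [puncturedDisc, and_comm]

namespace IsTestFunction

variable {Ω : Set Plane}

theorem gradSq (hu : IsTestFunction Ω u) : IsTestFunction Ω (gradSq u) :=
  (hu.partialDeriv 0).sq.add (hu.partialDeriv 1).sq

theorem hessSq (hu : IsTestFunction Ω u) : IsTestFunction Ω (hessSq u) :=
  (((hu.partialDeriv 0).partialDeriv 0).sq.add ((hu.partialDeriv 1).partialDeriv 0).sq).add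
    ((hu.partialDeriv 1).partialDeriv 1).sq

end IsTestFunction

theorem integrable_rhoWeight_mul (hf : IsTestFunction puncturedDisc f) (a : ℝ) :
    Integrable (fun x => rhoWeight ε x ^ a * f x) :=
  (hf.mono puncturedDisc_subset).integrable_weight_mul (contDiffOn_rhoWeight_rpow a)

theorem integral_mono_of_punctured {w w' : Plane → ℝ} (hf : IsTestFunction puncturedDisc f)
    (hg : IsTestFunction puncturedDisc g) (hw : ContDiffOn ℝ ∞ w {0}ᶜ)
    (hw' : ContDiffOn ℝ ∞ w' {0}ᶜ) (h : ∀ x, x ∈ puncturedDisc → w x * f x ≤ w' x * g x) :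
    ∫ x, w x * f x ≤ ∫ x, w' x * g x := by
  refine integral_mono ((hf.mono puncturedDisc_subset).integrable_weight_mul hw)
    ((hg.mono puncturedDisc_subset).integrable_weight_mul hw') fun x => ?_
  by_cases hx : x ∈ puncturedDisc
  · exact h x hx
  · simp [hf.eq_zero hx, hg.eq_zero hx]

/-- On the unit disc `ρ ≤ 1`, so lowering the exponent enlarges the weight. -/
theorem weightedIntegral_mono (hε : 0 < ε) (hf : IsTestFunction puncturedDisc f)
    (hg : IsTestFunction puncturedDisc g) (hba : b ≤ a) (hf0 : ∀ x, 0 ≤ f x)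
    (hfg : ∀ x, f x ≤ g x) : weightedIntegral ε a f ≤ weightedIntegral ε b g := by
  refine integral_mono_of_punctured hf hg (contDiffOn_rhoWeight_rpow a)
    (contDiffOn_rhoWeight_rpow b) fun x hx => ?_
  have h0 := mem_puncturedDisc.1 hx
  have hρ := rhoWeight_pos (ε := ε) h0.1
  have hρ1 : rhoWeight ε x ≤ 1 := (rhoWeight_le_norm hε).trans h0.2.le
  exact mul_le_mul (Real.rpow_le_rpow_of_exponent_ge hρ hρ1 hba) (hfg x) (hf0 x) (by positivity)

theorem weightedIntegral_nonneg (hf : ∀ x, 0 ≤ f x) : 0 ≤ weightedIntegral ε a f :=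
  integral_nonneg fun x => mul_nonneg (Real.rpow_nonneg (by
    unfold rhoWeight phiWeight; positivity) _) (hf x)

theorem weightedIntegral_add (hf : IsTestFunction puncturedDisc f)
    (hg : IsTestFunction puncturedDisc g) :
    weightedIntegral ε a (fun x => f x + g x) =
      weightedIntegral ε a f + weightedIntegral ε a g := by
  simp only [weightedIntegral]
  rw [← integral_add (integrable_rhoWeight_mul hf a) (integrable_rhoWeight_mul hg a)]
  simp only [mul_add]

theorem weightedIntegral_const_mul (c : ℝ) :
    weightedIntegral ε a (fun x => c * f x) = c * weightedIntegral ε a f := by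
  simp only [weightedIntegral, ← integral_const_mul]
  congr 1 with x
  ring

theorem gradSq_nonneg (u : Plane → ℝ) (x : Plane) : 0 ≤ gradSq u x := by
  unfold gradSq; positivity

theorem hessSq_nonneg (u : Plane → ℝ) (x : Plane) : 0 ≤ hessSq u x := by
  unfold hessSq; positivity

/-- The Carleman inequality for the Laplacian with gradient on the right, in the gain `ρ^(ε-2)`. -/
theorem weightedIntegral_gradSq_le_laplacian (hε : 0 < ε) (hb : b < 0)
    (hu : IsTestFunction puncturedDisc u) :
    ε / (4 * (2 ^ (1 / ε)) ^ 2) * (-b * weightedIntegral ε (b - 2 + ε) (gradSq u)) ≤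
      weightedIntegral ε b (fun x => (Δ u) x ^ 2) := by
  set K : ℝ := 2 ^ (1 / ε)
  have hK : 0 < K := by positivity
  have hφ := contDiffOn_carlemanPhase (ε := ε) (-b / 2) 0
  have h := integral_exp_mul_laplacian_mul_gradient_sq_le hφ (hu.mono puncturedDisc_subset)
  have hW : ContDiffOn ℝ ∞ (fun x => Real.exp (2 * carlemanPhase ε (-b / 2) 0 x)) {0}ᶜ :=
    (contDiffOn_const.mul hφ).exp
  have hdisc {x : Plane} (hx : x ≠ 0) :
      Real.exp (2 * carlemanPhase ε (-b / 2) 0 x) = rhoWeight ε x ^ b := by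
    rw [exp_two_mul_carlemanPhase hx]; simp
    congr 1; ring
  rw [← mul_assoc, ← weightedIntegral_const_mul]
  refine (integral_mono_of_punctured (f := fun x => ε / (4 * K ^ 2) * -b * gradSq u x)
    (g := fun x => 2 * gradSq u x)
    ?_ ?_ (contDiffOn_rhoWeight_rpow (b - 2 + ε)) (hW.mul (hφ.partialDeriv.partialDeriv.add
      hφ.partialDeriv.partialDeriv)) fun x hx => ?_).trans (h.trans_eq (integral_congr_ae ?_))
  · exact hu.gradSq.of_tsupport (contDiff_const.mul hu.gradSq.contDiff) tsupport_mul_subset_right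
  · exact hu.gradSq.of_tsupport (contDiff_const.mul hu.gradSq.contDiff) tsupport_mul_subset_right
  · have h0 := mem_puncturedDisc.1 hx
    have hρ := rhoWeight_pos (ε := ε) h0.1
    have hn : 0 < ‖x‖ := norm_pos_iff.2 h0.1
    rw [laplacian_carlemanPhase hε h0.1, hdisc h0.1, Real.rpow_add hρ, Real.rpow_sub hρ]
    have h1 : ‖x‖ ^ ε ≤ 1 := Real.rpow_le_one hn.le h0.2.le hε.le
    have h2 : rhoWeight ε x ^ ε ≤ ‖x‖ ^ ε :=
      Real.rpow_le_rpow hρ.le (rhoWeight_le_norm hε) hε.le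
    have h3 : ‖x‖ ^ 2 ≤ K ^ 2 * rhoWeight ε x ^ 2 := by
      rw [← mul_pow]
      exact pow_le_pow_left₀ hn.le (norm_le_mul_rhoWeight hε h0.2.le) 2
    have h4 : 0 < ‖x‖ ^ ε := by positivity
    -- The constant arises from `|x|² ≤ K²ρ²` and `(1 + |x|^ε)² ≤ 4`; the `2` in Hörmander's
    -- inequality cancels the one in `σ = -b/2`.
    have h5 : rhoWeight ε x ^ ε / (K ^ 2 * rhoWeight ε x ^ 2 * 4) ≤
        ‖x‖ ^ ε / (‖x‖ ^ 2 * (1 + ‖x‖ ^ ε) ^ 2) := by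
      refine div_le_div₀ h4.le h2 (by positivity) (mul_le_mul h3 ?_ (by positivity) (by positivity))
      nlinarith
    have h6 := gradSq_nonneg u x
    have h7 : 0 ≤ rhoWeight ε x ^ b * (-b * ε) * gradSq u x := by
      have := neg_pos.2 hb
      positivity
    have h8 := mul_le_mul_of_nonneg_left h5 h7
    have e2 : rhoWeight ε x ^ (2 : ℝ) = rhoWeight ε x ^ 2 := Real.rpow_two _
    rw [e2]
    refine le_trans (le_of_eq ?_) (h8.trans_eq ?_)
    · field_simp
    · rw [zero_div, add_zero]
      ring
  · filter_upwards [ae_ne_zero_plane] with x hx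
    rw [hdisc hx]

/-- The Carleman inequality for the Laplacian away from the disc of radius `r / 4`. -/
theorem mul_weightedIntegral_gradSq_le_laplacian {r : ℝ} (hε : 0 < ε) (hb : b ≤ 0) (hr : 0 < r)
    (hu : IsTestFunction (Metric.ball 0 1 \ Metric.closedBall 0 (r / 4)) u) :
    2 / ((2 ^ (1 / ε)) ^ 3 * Real.exp 8) * (r * weightedIntegral ε (b - 3) (gradSq u)) ≤
      weightedIntegral ε b (fun x => (Δ u) x ^ 2) := by
  set K : ℝ := 2 ^ (1 / ε)
  have hK : 0 < K := by positivity
  have hφ := contDiffOn_carlemanPhase (ε := ε) (-b / 2) r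
  have hu1 : IsTestFunction puncturedDisc u := hu.mono fun x hx =>
    ⟨hx.1, fun h => hx.2 (by rw [Set.mem_singleton_iff.1 h]; simp; positivity)⟩
  have h := integral_exp_mul_laplacian_mul_gradient_sq_le hφ (hu1.mono puncturedDisc_subset)
  have hW : ContDiffOn ℝ ∞ (fun x => Real.exp (2 * carlemanPhase ε (-b / 2) r x)) {0}ᶜ :=
    (contDiffOn_const.mul hφ).exp
  have hdisc {x : Plane} (hx : x ≠ 0) : Real.exp (2 * carlemanPhase ε (-b / 2) r x) =
      rhoWeight ε x ^ b * Real.exp (2 * (r * ‖x‖⁻¹)) := by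
    rw [exp_two_mul_carlemanPhase hx]
    congr 2; ring
  have hsmul (c : ℝ) {f : Plane → ℝ} (hf : IsTestFunction puncturedDisc f) :
      IsTestFunction puncturedDisc (fun x => c * f x) :=
    hf.of_tsupport (contDiff_const.mul hf.contDiff) tsupport_mul_subset_right
  have hlow : ∫ x, rhoWeight ε x ^ (b - 3) * (2 / K ^ 3 * r * gradSq u x) ≤
      ∫ x, (Real.exp (2 * carlemanPhase ε (-b / 2) r x) *
        (partialDeriv 0 (partialDeriv 0 (carlemanPhase ε (-b / 2) r)) x +
          partialDeriv 1 (partialDeriv 1 (carlemanPhase ε (-b / 2) r)) x)) * (2 * gradSq u x) := by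
    refine integral_mono_of_punctured (hsmul _ hu1.gradSq) (hsmul 2 hu1.gradSq)
      (contDiffOn_rhoWeight_rpow (b - 3)) (hW.mul (hφ.partialDeriv.partialDeriv.add
      hφ.partialDeriv.partialDeriv)) fun x hx => ?_
    have h0 := mem_puncturedDisc.1 hx
    have hρ := rhoWeight_pos (ε := ε) h0.1
    have hn : 0 < ‖x‖ := norm_pos_iff.2 h0.1
    have e3 : rhoWeight ε x ^ (3 : ℝ) = rhoWeight ε x ^ 3 := by
      exact_mod_cast Real.rpow_natCast _ 3
    rw [laplacian_carlemanPhase hε h0.1, hdisc h0.1, Real.rpow_sub hρ, e3]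
    have h3 : ‖x‖ ^ 3 ≤ K ^ 3 * rhoWeight ε x ^ 3 := by
      rw [← mul_pow]
      exact pow_le_pow_left₀ hn.le (norm_le_mul_rhoWeight hε h0.2.le) 3
    have h5 : r / (K ^ 3 * rhoWeight ε x ^ 3) ≤ r / ‖x‖ ^ 3 := by gcongr
    have h6 := gradSq_nonneg u x
    have h7 : 0 ≤ -b / 2 * ε * ‖x‖ ^ ε / (‖x‖ ^ 2 * (1 + ‖x‖ ^ ε) ^ 2) := by
      have : 0 ≤ -b := by linarith
      positivity
    -- For the lower bound the exponential is replaced by `1`, and the first, nonnegative term of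
    -- the Laplacian is discarded.
    have h8 : 1 ≤ Real.exp (2 * (r * ‖x‖⁻¹)) := Real.one_le_exp (by positivity)
    calc rhoWeight ε x ^ b / rhoWeight ε x ^ 3 * (2 / K ^ 3 * r * gradSq u x)
        = rhoWeight ε x ^ b * 1 * (r / (K ^ 3 * rhoWeight ε x ^ 3)) * (2 * gradSq u x) := by
          field_simp
      _ ≤ _ := by
          gcongr
          linarith
  have hup : ∫ x, Real.exp (2 * carlemanPhase ε (-b / 2) r x) * (Δ u) x ^ 2 ≤
      ∫ x, rhoWeight ε x ^ b * (Real.exp 8 * (Δ u) x ^ 2) := by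
    refine integral_mono_of_punctured hu1.laplacian.sq (hsmul _ hu1.laplacian.sq) hW
      (contDiffOn_rhoWeight_rpow b) fun x hx => ?_
    have h0 := mem_puncturedDisc.1 hx
    have hρ := rhoWeight_pos (ε := ε) h0.1
    by_cases hx' : x ∈ Metric.ball 0 1 \ Metric.closedBall (0 : Plane) (r / 4)
    · have hn : 0 < ‖x‖ := norm_pos_iff.2 h0.1
      have h1 : r / 4 < ‖x‖ := by simpa using hx'.2
      have h2 : 2 * (r * ‖x‖⁻¹) ≤ 8 := by
        rw [← div_eq_mul_inv, ← le_div_iff₀' (by norm_num), div_le_iff₀ hn]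
        linarith
      rw [hdisc h0.1, mul_assoc]
      gcongr
    · simp [hu.laplacian.eq_zero hx']
  have hfin := hlow.trans (h.trans hup)
  change weightedIntegral ε (b - 3) (fun x => 2 / K ^ 3 * r * gradSq u x) ≤
    weightedIntegral ε b (fun x => Real.exp 8 * (Δ u) x ^ 2) at hfin
  rw [weightedIntegral_const_mul, weightedIntegral_const_mul] at hfin
  rw [← div_le_iff₀' (Real.exp_pos 8)] at hfin
  refine le_trans (le_of_eq ?_) hfin
  field_simp

/-- A Hardy inequality with the radial weight. -/
theorem weightedIntegral_sq_le_gradSq (hε : 0 < ε)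
    (hu : IsTestFunction puncturedDisc u) :
    1 / (16 * (2 ^ (1 / ε)) ^ 2) * (b ^ 2 * weightedIntegral ε (b - 2) (fun x => u x ^ 2)) ≤
      weightedIntegral ε b (gradSq u) := by
  set K : ℝ := 2 ^ (1 / ε)
  have hK : 0 < K := by positivity
  have hρb := contDiffOn_rhoWeight_rpow (ε := ε) b
  have hcoord (i : Fin 2) : ContDiffOn ℝ ∞ (fun x : Plane => x i) {0}ᶜ :=
    (EuclideanSpace.proj i : Plane →L[ℝ] ℝ).contDiff.contDiffOn
  have hsq : ContDiffOn ℝ ∞ (fun x : Plane => (‖x‖ ^ 2)⁻¹) {0}ᶜ :=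
    (contDiffOn_norm_punctured.pow 2).inv fun x hx => pow_ne_zero 2 (norm_ne_zero_iff.2 hx)
  have hG (i : Fin 2) : ContDiffOn ℝ ∞
      (fun x : Plane => rhoWeight ε x ^ b * (x i * (‖x‖ ^ 2)⁻¹)) {0}ᶜ :=
    hρb.mul ((hcoord i).mul hsq)
  -- The Hardy field is `(b/4) ρ^b x/|x|²`. As `x/|x|²` is divergence free in the plane, only `ρ^b`
  -- contributes to the divergence, which is therefore proportional to `b²`.
  have hcG (i : Fin 2) : ContDiffOn ℝ ∞
      (fun x : Plane => b / 4 * (rhoWeight ε x ^ b * (x i * (‖x‖ ^ 2)⁻¹))) {0}ᶜ :=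
    contDiffOn_const.mul (hG i)
  have hdG (i : Fin 2) {x : Plane} (hx : x ≠ 0) :
      partialDeriv i (fun x => b / 4 * (rhoWeight ε x ^ b * (x i * (‖x‖ ^ 2)⁻¹))) x =
        b / 4 * (rhoWeight ε x ^ b * (b * (x i ^ 2 / (‖x‖ ^ 4 * (1 + ‖x‖ ^ ε))) +
          1 / ‖x‖ ^ 2 - 2 * x i ^ 2 / ‖x‖ ^ 4)) := by
    have hn : 0 < ‖x‖ := norm_pos_iff.2 hx
    have h1 : HasDerivAt (fun s : ℝ => (s ^ 2)⁻¹) (-(2 * ‖x‖) / (‖x‖ ^ 2) ^ 2) ‖x‖ := by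
      simpa using (hasDerivAt_pow 2 ‖x‖).fun_inv (by positivity)
    rw [partialDeriv_const_mul _ ((hG i).differentiableAt_punctured hx),
      partialDeriv_mul (hρb.differentiableAt_punctured hx)
        (((hcoord i).mul hsq).differentiableAt_punctured hx),
      partialDeriv_mul (differentiableAt_coord i x) (hsq.differentiableAt_punctured hx),
      partialDeriv_comp h1 (contDiffOn_norm_punctured.differentiableAt_punctured hx),
      partialDeriv_norm hx, partialDeriv_coord, partialDeriv_rhoWeight_rpow hε hx, if_pos rfl]
    field_simp
    ring
  rw [← mul_assoc, ← weightedIntegral_const_mul]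
  have h := integral_divergence_mul_sq_le (hcG 0) (hcG 1) hρb (hu.mono puncturedDisc_subset)
    (v := fun x => 1 / (16 * K ^ 2) * b ^ 2 * rhoWeight ε x ^ (b - 2))
    (contDiffOn_const.mul (contDiffOn_rhoWeight_rpow (b - 2))) ?_
  · refine le_trans (le_of_eq (integral_congr_ae (ae_of_all _ fun x => ?_))) h
    ring
  · intro x hx
    have h0 := mem_puncturedDisc.1 (hu.tsupport_subset hx)
    have hρ := rhoWeight_pos (ε := ε) h0.1
    have hn : 0 < ‖x‖ := norm_pos_iff.2 h0.1
    have hH : ‖x‖ ^ ε ≤ 1 := Real.rpow_le_one hn.le h0.2.le hε.le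
    have hH0 : 0 < ‖x‖ ^ ε := by positivity
    rw [hdG 0 h0.1, hdG 1 h0.1, Real.rpow_sub hρ, Real.rpow_two]
    have hN := norm_sq_plane x
    have hdiv : b / 4 * (rhoWeight ε x ^ b * (b * (x 0 ^ 2 / (‖x‖ ^ 4 * (1 + ‖x‖ ^ ε))) +
          1 / ‖x‖ ^ 2 - 2 * x 0 ^ 2 / ‖x‖ ^ 4)) +
        b / 4 * (rhoWeight ε x ^ b * (b * (x 1 ^ 2 / (‖x‖ ^ 4 * (1 + ‖x‖ ^ ε))) +
          1 / ‖x‖ ^ 2 - 2 * x 1 ^ 2 / ‖x‖ ^ 4)) =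
        rhoWeight ε x ^ b * (b ^ 2 / 4 * (1 / (‖x‖ ^ 2 * (1 + ‖x‖ ^ ε)))) := by
      have e : x 1 ^ 2 = ‖x‖ ^ 2 - x 0 ^ 2 := by linarith
      rw [e]
      field_simp
      ring
    have hdiv' : b ^ 2 / 8 / ‖x‖ ^ 2 ≤ b ^ 2 / 4 * (1 / (‖x‖ ^ 2 * (1 + ‖x‖ ^ ε))) := by
      calc b ^ 2 / 8 / ‖x‖ ^ 2 = b ^ 2 / 4 * (1 / (‖x‖ ^ 2 * 2)) := by ring
        _ ≤ _ := by gcongr; linarith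
    have hK2 : 1 / (K ^ 2 * rhoWeight ε x ^ 2) ≤ 1 / ‖x‖ ^ 2 := by
      rw [← mul_pow]
      gcongr
      exact norm_le_mul_rhoWeight hε h0.2.le
    rw [hdiv]
    generalize partialDeriv 0 u x = p
    generalize partialDeriv 1 u x = q
    generalize u x = z
    have hW : 0 < rhoWeight ε x ^ b := by positivity
    generalize rhoWeight ε x ^ b = W at *
    -- Completing the square costs `b²/16`, half of the `b²/8` available from the divergence; the
    -- other half is the gain.
    have key : 0 ≤ b ^ 2 / 16 / ‖x‖ ^ 2 * z ^ 2 + (p ^ 2 + q ^ 2) +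
        2 * z * (b / 4 * (x 0 * p + x 1 * q) / ‖x‖ ^ 2) := by
      have : b ^ 2 / 16 / ‖x‖ ^ 2 * z ^ 2 + (p ^ 2 + q ^ 2) +
        2 * z * (b / 4 * (x 0 * p + x 1 * q) / ‖x‖ ^ 2) =
        (b / 4 * z * x 0 / ‖x‖ ^ 2 + p) ^ 2 + (b / 4 * z * x 1 / ‖x‖ ^ 2 + q) ^ 2 := by
        have e : x 1 ^ 2 = ‖x‖ ^ 2 - x 0 ^ 2 := by linarith
        field_simp
        ring_nf
        rw [e]
        ring
      rw [this]
      positivity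
    have k1 := mul_nonneg hW.le key
    have k2 := mul_le_mul_of_nonneg_left hdiv' (by positivity : 0 ≤ W * z ^ 2)
    have k3 := mul_le_mul_of_nonneg_left hK2 (by positivity : 0 ≤ W * z ^ 2 * (b ^ 2 / 16))
    have e4 : 1 / (16 * K ^ 2) * b ^ 2 * (W / rhoWeight ε x ^ 2) * z ^ 2 =
        W * z ^ 2 * (b ^ 2 / 16) * (1 / (K ^ 2 * rhoWeight ε x ^ 2)) := by
      field_simp
    rw [e4]
    have e5 : 2 * z * (b / 4 * (W * (x 0 * (‖x‖ ^ 2)⁻¹)) * p + b / 4 * (W * (x 1 * (‖x‖ ^ 2)⁻¹)) * q) =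
        W * (2 * z * (b / 4 * (x 0 * p + x 1 * q) / ‖x‖ ^ 2)) := by ring
    rw [e5]
    have e6 : W * z ^ 2 * (b ^ 2 / 16) * (1 / ‖x‖ ^ 2) = W * (b ^ 2 / 16 / ‖x‖ ^ 2 * z ^ 2) := by
      ring
    have e7 : W * z ^ 2 * (b ^ 2 / 8 / ‖x‖ ^ 2) = 2 * (W * (b ^ 2 / 16 / ‖x‖ ^ 2 * z ^ 2)) := by
      ring
    linarith

/-- Control of second derivatives by the Laplacian and the gradient. -/
theorem weightedIntegral_hessSq_le (hε : 0 < ε) (hu : IsTestFunction puncturedDisc u) :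
    weightedIntegral ε b (hessSq u) ≤ 2 * weightedIntegral ε b (fun x => (Δ u) x ^ 2) +
      8 * (b ^ 2 * weightedIntegral ε (b - 2) (gradSq u)) := by
  have h := integral_weight_mul_hessian_sq_le (w := fun x => rhoWeight ε x ^ b)
    (v := fun x => b ^ 2 * rhoWeight ε x ^ (b - 2)) (contDiffOn_rhoWeight_rpow b)
    (contDiffOn_const.mul (contDiffOn_rhoWeight_rpow (b - 2))) (hu.mono puncturedDisc_subset)
    (fun x hx => Real.rpow_pos_of_pos (rhoWeight_pos (hu.tsupport_subset hx).2) _) ?_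
  · rw [← weightedIntegral_const_mul (b ^ 2)]
    have e : weightedIntegral ε (b - 2) (fun x => b ^ 2 * gradSq u x) =
        ∫ x, b ^ 2 * rhoWeight ε x ^ (b - 2) *
          (partialDeriv 0 u x ^ 2 + partialDeriv 1 u x ^ 2) :=
      integral_congr_ae (ae_of_all _ fun x => by simp only [gradSq]; ring)
    rw [e]
    exact h
  · intro x hx i
    have hx0 : x ≠ 0 := (hu.tsupport_subset hx).2
    have hρ := rhoWeight_pos (ε := ε) hx0
    have hn : 0 < ‖x‖ := norm_pos_iff.2 hx0
    rw [partialDeriv_rhoWeight_rpow hε hx0, Real.rpow_sub hρ, Real.rpow_two]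
    have h1 : x i ^ 2 ≤ ‖x‖ ^ 2 := by
      rw [norm_sq_plane]
      fin_cases i <;> simp <;> positivity
    have h2 : 1 ≤ (1 + ‖x‖ ^ ε) ^ 2 := by
      have : 0 ≤ ‖x‖ ^ ε := by positivity
      nlinarith
    have h3 : rhoWeight ε x ^ 2 ≤ ‖x‖ ^ 2 := pow_le_pow_left₀ hρ.le (rhoWeight_le_norm hε) 2
    -- The gradient of `log ρ` is bounded by `1/|x| ≤ 1/ρ`.
    have h4 : (x i * (‖x‖ ^ 2 * (1 + ‖x‖ ^ ε))⁻¹) ^ 2 ≤ 1 / rhoWeight ε x ^ 2 := by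
      calc (x i * (‖x‖ ^ 2 * (1 + ‖x‖ ^ ε))⁻¹) ^ 2
          = x i ^ 2 / (‖x‖ ^ 2 * ‖x‖ ^ 2 * (1 + ‖x‖ ^ ε) ^ 2) := by field_simp
        _ ≤ ‖x‖ ^ 2 / (‖x‖ ^ 2 * rhoWeight ε x ^ 2 * 1) := by gcongr
        _ = 1 / rhoWeight ε x ^ 2 := by field_simp
    calc _ = (b * rhoWeight ε x ^ b) ^ 2 * (x i * (‖x‖ ^ 2 * (1 + ‖x‖ ^ ε))⁻¹) ^ 2 := by ring
      _ ≤ (b * rhoWeight ε x ^ b) ^ 2 * (1 / rhoWeight ε x ^ 2) := by gcongr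
      _ = _ := by ring

end

/-! ### The Carleman estimate for the cube of the Laplacian -/

section

variable {u : Plane → ℝ}

/-! ### Derivatives of order at most four in terms of gradients and Hessians. -/

theorem normSqD_zero : normSqD 0 u = fun x => u x ^ 2 := by
  funext x
  simp [normSqD, multiDeriv]

theorem normSqD_one : normSqD 1 u = gradSq u := by
  funext x
  simp [normSqD, multiDeriv, gradSq, Finset.Nat.antidiagonal_succ, add_comm]

theorem normSqD_two : normSqD 2 u = hessSq u := by
  funext x
  simp [normSqD, multiDeriv, hessSq, Finset.Nat.antidiagonal_succ]
  ring

theorem normSqD_three : normSqD 3 u = fun x =>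
    partialDeriv 0 (partialDeriv 0 (partialDeriv 0 u)) x ^ 2 +
      partialDeriv 0 (partialDeriv 0 (partialDeriv 1 u)) x ^ 2 +
      partialDeriv 0 (partialDeriv 1 (partialDeriv 1 u)) x ^ 2 +
      partialDeriv 1 (partialDeriv 1 (partialDeriv 1 u)) x ^ 2 := by
  funext x
  simp [normSqD, multiDeriv, Finset.Nat.antidiagonal_succ]
  ring

theorem normSqD_four : normSqD 4 u = fun x =>
    partialDeriv 0 (partialDeriv 0 (partialDeriv 0 (partialDeriv 0 u))) x ^ 2 +
      partialDeriv 0 (partialDeriv 0 (partialDeriv 0 (partialDeriv 1 u))) x ^ 2 +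
      partialDeriv 0 (partialDeriv 0 (partialDeriv 1 (partialDeriv 1 u))) x ^ 2 +
      partialDeriv 0 (partialDeriv 1 (partialDeriv 1 (partialDeriv 1 u))) x ^ 2 +
      partialDeriv 1 (partialDeriv 1 (partialDeriv 1 (partialDeriv 1 u))) x ^ 2 := by
  funext x
  simp [normSqD, multiDeriv, Finset.Nat.antidiagonal_succ]
  ring

theorem normSqD_nonneg (k : ℕ) (x : Plane) : 0 ≤ normSqD k u x :=
  Finset.sum_nonneg fun _ _ => by positivity

theorem IsTestFunction.iterate_partialDeriv {Ω : Set Plane} (hu : IsTestFunction Ω u) (i : Fin 2)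
    (n : ℕ) : IsTestFunction Ω ((_root_.partialDeriv i)^[n] u) := by
  induction n with
  | zero => exact hu
  | succ n ih => rw [Function.iterate_succ_apply']; exact ih.partialDeriv i

theorem IsTestFunction.normSqD {Ω : Set Plane} (hu : IsTestFunction Ω u) (k : ℕ) :
    IsTestFunction Ω (normSqD k u) := by
  have h (α : ℕ × ℕ) : IsTestFunction Ω (fun x => |multiDeriv α u x| ^ 2) := by
    simp only [sq_abs]
    exact ((hu.iterate_partialDeriv 1 α.2).iterate_partialDeriv 0 α.1).sq
  have hs (s : Finset (ℕ × ℕ)) :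
      IsTestFunction Ω (fun x => ∑ α ∈ s, |multiDeriv α u x| ^ 2) := by
    classical
    induction s using Finset.induction_on with
    | empty =>
      simp only [Finset.sum_empty]
      exact hu.of_tsupport contDiff_const (by
        rw [show (fun _ : Plane => (0 : ℝ)) = 0 from rfl, tsupport_zero]; exact Set.empty_subset _)
    | insert a s ha ih =>
      simp only [Finset.sum_insert ha]
      exact (h a).add ih
  exact hs _

theorem hessSq_partialDeriv (hu : ContDiff ℝ ∞ u) (x : Plane) :
    normSqD 3 u x ≤ hessSq (partialDeriv 0 u) x + hessSq (partialDeriv 1 u) x := by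
  rw [normSqD_three]
  simp only [hessSq, partialDeriv_comm hu 1 0]
  have h : partialDeriv 1 (partialDeriv 0 (partialDeriv 1 u)) =
      partialDeriv 0 (partialDeriv 1 (partialDeriv 1 u)) :=
    partialDeriv_comm hu.partialDeriv 1 0
  rw [h]
  nlinarith [sq_nonneg (partialDeriv 0 (partialDeriv 0 (partialDeriv 1 u)) x),
    sq_nonneg (partialDeriv 0 (partialDeriv 1 (partialDeriv 1 u)) x)]

theorem gradSq_partialDeriv (hu : ContDiff ℝ ∞ u) (x : Plane) :
    gradSq (partialDeriv 0 u) x + gradSq (partialDeriv 1 u) x ≤ 2 * hessSq u x := by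
  simp only [hessSq, gradSq, partialDeriv_comm hu 1 0]
  nlinarith [sq_nonneg (partialDeriv 0 (partialDeriv 0 u) x),
    sq_nonneg (partialDeriv 1 (partialDeriv 1 u) x)]

/-- The Hessians of the two pure second derivatives already contain every fourth derivative, so the
mixed one is not needed. -/
theorem hessSq_partialDeriv_partialDeriv (hu : ContDiff ℝ ∞ u) (x : Plane) :
    normSqD 4 u x ≤ hessSq (partialDeriv 0 (partialDeriv 0 u)) x +
      hessSq (partialDeriv 1 (partialDeriv 1 u)) x := by
  have h2 := hu.partialDeriv (i := 0)
  have h3 := hu.partialDeriv (i := 1)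
  rw [normSqD_four]
  simp only [hessSq, partialDeriv_comm h2 1 0, partialDeriv_comm hu 1 0, partialDeriv_comm h3 1 0,
    partialDeriv_comm (h3.partialDeriv (i := 0)) 1 0]
  nlinarith [sq_nonneg (partialDeriv 0 (partialDeriv 0 (partialDeriv 1 (partialDeriv 1 u))) x)]

theorem gradSq_partialDeriv_partialDeriv (hu : ContDiff ℝ ∞ u) (x : Plane) :
    gradSq (partialDeriv 0 (partialDeriv 0 u)) x + gradSq (partialDeriv 1 (partialDeriv 1 u)) x =
      normSqD 3 u x := by
  have h2 := hu.partialDeriv (i := 0)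
  rw [normSqD_three]
  simp only [gradSq, partialDeriv_comm h2 1 0, partialDeriv_comm hu 1 0]
  ring

theorem sq_laplacian_partialDeriv_partialDeriv {Ω : Set Plane} (hu : IsTestFunction Ω u)
    (x : Plane) :
    (Δ (partialDeriv 0 (partialDeriv 0 u))) x ^ 2 +
      (Δ (partialDeriv 1 (partialDeriv 1 u))) x ^ 2 ≤ hessSq (Δ u) x := by
  simp only [hessSq, hu.partialDeriv_laplacian, (hu.partialDeriv _).partialDeriv_laplacian]
  nlinarith [sq_nonneg ((Δ (partialDeriv 0 (partialDeriv 1 u))) x)]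

theorem sq_laplacian_partialDeriv {Ω : Set Plane} (hu : IsTestFunction Ω u) (x : Plane) :
    (Δ (partialDeriv 0 u)) x ^ 2 + (Δ (partialDeriv 1 u)) x ^ 2 = gradSq (Δ u) x := by
  simp only [gradSq, hu.partialDeriv_laplacian]

/-- Third derivatives are controlled by the gradient of the Laplacian and the Hessian. -/
theorem weightedIntegral_normSqD_three_le {ε b : ℝ} (hε : 0 < ε)
    (hu : IsTestFunction puncturedDisc u) :
    weightedIntegral ε b (normSqD 3 u) ≤ 2 * weightedIntegral ε b (gradSq (Δ u)) +
      16 * (b ^ 2 * weightedIntegral ε (b - 2) (hessSq u)) := by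
  have hx := hu.partialDeriv
  have h1 := weightedIntegral_mono (a := b) hε (hu.normSqD 3) ((hx 0).hessSq.add (hx 1).hessSq) le_rfl
    (normSqD_nonneg 3) (hessSq_partialDeriv hu.contDiff)
  have hH2 : IsTestFunction puncturedDisc (fun x => 2 * hessSq u x) :=
    hu.hessSq.of_tsupport (contDiff_const.mul hu.hessSq.contDiff) tsupport_mul_subset_right
  have h2 := weightedIntegral_mono (a := b - 2) hε ((hx 0).gradSq.add (hx 1).gradSq) hH2 le_rfl
    (fun x => add_nonneg (gradSq_nonneg _ x) (gradSq_nonneg _ x)) (gradSq_partialDeriv hu.contDiff)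
  have h3 := weightedIntegral_add (ε := ε) (a := b) (hx 0).laplacian.sq (hx 1).laplacian.sq
  simp only [sq_laplacian_partialDeriv hu] at h3
  rw [weightedIntegral_add (hx 0).hessSq (hx 1).hessSq] at h1
  rw [weightedIntegral_add (hx 0).gradSq (hx 1).gradSq, weightedIntegral_const_mul] at h2
  change weightedIntegral ε b (gradSq (Δ u)) = _ at h3
  have h4 := weightedIntegral_hessSq_le (b := b) hε (hx 0)
  have h5 := weightedIntegral_hessSq_le (b := b) hε (hx 1)
  have h6 := mul_le_mul_of_nonneg_left h2 (sq_nonneg b)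
  linarith

/-- Fourth derivatives are controlled by the Hessian of the Laplacian and the third derivatives. -/
theorem weightedIntegral_normSqD_four_le {ε b : ℝ} (hε : 0 < ε)
    (hu : IsTestFunction puncturedDisc u) :
    weightedIntegral ε b (normSqD 4 u) ≤ 2 * weightedIntegral ε b (hessSq (Δ u)) +
      8 * (b ^ 2 * weightedIntegral ε (b - 2) (normSqD 3 u)) := by
  have hx := fun i => (hu.partialDeriv i).partialDeriv i
  have h1 := weightedIntegral_mono (a := b) hε (hu.normSqD 4) ((hx 0).hessSq.add (hx 1).hessSq) le_rfl
    (normSqD_nonneg 4) (hessSq_partialDeriv_partialDeriv hu.contDiff)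
  have h2 := weightedIntegral_add (ε := ε) (a := b - 2) (hx 0).gradSq (hx 1).gradSq
  simp only [gradSq_partialDeriv_partialDeriv hu.contDiff] at h2
  change weightedIntegral ε (b - 2) (normSqD 3 u) = _ at h2
  have h3 := weightedIntegral_mono (a := b) hε ((hx 0).laplacian.sq.add (hx 1).laplacian.sq)
    hu.laplacian.hessSq le_rfl (fun x => by positivity)
    (sq_laplacian_partialDeriv_partialDeriv hu)
  rw [weightedIntegral_add (hx 0).hessSq (hx 1).hessSq] at h1
  rw [weightedIntegral_add (hx 0).laplacian.sq (hx 1).laplacian.sq] at h3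
  have h4 := weightedIntegral_hessSq_le (b := b) hε (hx 0)
  have h5 := weightedIntegral_hessSq_le (b := b) hε (hx 1)
  rw [h2]
  linarith

end

/-! ### Iteration of the one-step inequalities. -/

theorem carlemanSource_eq (ε τ : ℝ) (u : Plane → ℝ) :
    carlemanSource ε τ u = weightedIntegral ε (4 - 2 * τ) (fun x => (Δ (Δ (Δ u))) x ^ 2) := by
  simp only [carlemanSource, weightedIntegral, sq_abs]

theorem carlemanControl_eq (ε τ : ℝ) (u : Plane → ℝ) :
    carlemanControl ε τ u =
      τ * weightedIntegral ε (2 + ε - 2 * τ) (gradSq (Δ (Δ u))) +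
      (τ ^ 9 * weightedIntegral ε (5 * ε - 8 - 2 * τ) (fun x => u x ^ 2) +
        τ ^ 7 * weightedIntegral ε (5 * ε - 6 - 2 * τ) (gradSq u) +
        τ ^ 5 * weightedIntegral ε (5 * ε - 4 - 2 * τ) (hessSq u) +
        τ ^ 3 * weightedIntegral ε (5 * ε - 2 - 2 * τ) (normSqD 3 u) +
        τ * weightedIntegral ε (5 * ε - 2 * τ) (normSqD 4 u)) := by
  rw [← normSqD_one, ← normSqD_one, ← normSqD_two, ← normSqD_zero]
  simp only [carlemanControl, Finset.sum_range_succ, Finset.sum_range_zero]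
  have e (a : ℝ) (f : Plane → ℝ) :
      ∫ x, rhoWeight ε x ^ a * f x = weightedIntegral ε a f := rfl
  simp only [e]
  norm_num
  ring_nf

/-- The two basic inequalities, for weights `ρ^(a - 2τ)` with `a` in a bounded range. -/
theorem exists_carleman_constant {ε : ℝ} (hε : 0 < ε) : ∃ c : ℝ, 0 < c ∧ c ≤ 1 ∧
    (∀ τ a : ℝ, 12 ≤ τ → |a| ≤ 12 → ∀ u, IsTestFunction puncturedDisc u →
      c * (τ * weightedIntegral ε (a - 2 + ε - 2 * τ) (gradSq u)) ≤
          weightedIntegral ε (a - 2 * τ) (fun x => (Δ u) x ^ 2) ∧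
        c * (τ ^ 2 * weightedIntegral ε (a - 2 - 2 * τ) (fun x => u x ^ 2)) ≤
          weightedIntegral ε (a - 2 * τ) (gradSq u)) ∧
    ∀ τ a r : ℝ, 12 ≤ τ → |a| ≤ 12 → 0 < r → ∀ u,
      IsTestFunction (Metric.ball 0 1 \ Metric.closedBall 0 (r / 4)) u →
      c * (r * weightedIntegral ε (a - 3 - 2 * τ) (gradSq u)) ≤
        weightedIntegral ε (a - 2 * τ) (fun x => (Δ u) x ^ 2) := by
  set c₁ := ε / (4 * ((2 : ℝ) ^ (1 / ε)) ^ 2) with hc₁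
  set c₂ := 1 / (16 * ((2 : ℝ) ^ (1 / ε)) ^ 2) with hc₂
  set c₃ := 2 / (((2 : ℝ) ^ (1 / ε)) ^ 3 * Real.exp 8) with hc₃
  have h₁ : 0 < c₁ := by positivity
  have h₂ : 0 < c₂ := by positivity
  have h₃ : 0 < c₃ := by positivity
  refine ⟨min (min c₁ c₂) (min c₃ 1), by positivity, by simp, fun τ a hτ ha u hu => ⟨?_, ?_⟩,
    fun τ a r hτ ha hr u hu => ?_⟩
  all_goals
    have ha' := abs_le.1 ha
    have hb : a - 2 * τ < 0 := by linarith
    -- From `a ≤ 12 ≤ τ`: the exponent `a - 2τ` is at least `τ` in size, which turns its powers into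
    -- powers of `τ`.
    have hle : τ ≤ -(a - 2 * τ) := by linarith
  · have h := weightedIntegral_gradSq_le_laplacian hε hb hu
    rw [show a - 2 * τ - 2 + ε = a - 2 + ε - 2 * τ by ring] at h
    have h0 : 0 ≤ weightedIntegral ε (a - 2 + ε - 2 * τ) (gradSq u) :=
      weightedIntegral_nonneg (gradSq_nonneg u)
    refine le_trans ?_ h
    gcongr
    exact (min_le_left _ _).trans (min_le_left _ _)
  · have h := weightedIntegral_sq_le_gradSq (b := a - 2 * τ) hε hu
    rw [show a - 2 * τ - 2 = a - 2 - 2 * τ by ring] at h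
    have h0 : 0 ≤ weightedIntegral ε (a - 2 - 2 * τ) (fun x => u x ^ 2) :=
      weightedIntegral_nonneg fun x => sq_nonneg _
    refine le_trans ?_ h
    have h2 : τ ^ 2 ≤ (a - 2 * τ) ^ 2 := by nlinarith
    gcongr
    exact (min_le_left _ _).trans (min_le_right _ _)
  · have h := mul_weightedIntegral_gradSq_le_laplacian hε hb.le hr hu
    rw [show a - 2 * τ - 3 = a - 3 - 2 * τ by ring] at h
    have h0 : 0 ≤ weightedIntegral ε (a - 3 - 2 * τ) (gradSq u) :=
      weightedIntegral_nonneg (gradSq_nonneg u)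
    refine le_trans ?_ h
    gcongr
    exact (min_le_right _ _).trans (min_le_left _ _)

/-- One link of the descent: a bound of `Y` by the source `S` passes to `X` at the cost of a factor
`M = 1/c`. -/
theorem le_mul_of_mul_le_of_le {c M m X Y S Z : ℝ} (hcM : M * c = 1) (hc : 0 < c) (hm : 0 ≤ m)
    (h : c * X ≤ Y) (hY : m * Y ≤ Z * S) : m * X ≤ M * Z * S := by
  have hM : 0 ≤ M := by
    by_contra hM
    nlinarith
  calc m * X = M * (m * (c * X)) := by linear_combination (-m * X) * hcM
    _ ≤ M * (m * Y) := by gcongr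
    _ ≤ M * (Z * S) := by gcongr
    _ = M * Z * S := by ring

/-- Six links of the descent cost `M ^ 6`; the numerical factor covers the recovery of the full
second, third and fourth derivatives. -/
theorem carlemanControl_le {ε τ c M : ℝ} {u : Plane → ℝ} (hε : 0 < ε) (hε' : ε ≤ 1 / 5)
    (hτ : 12 ≤ τ) (hc : 0 < c) (hcM : M * c = 1) (hM : 1 ≤ M)
    (hstep : ∀ a : ℝ, |a| ≤ 12 → ∀ u, IsTestFunction puncturedDisc u →
      c * (τ * weightedIntegral ε (a - 2 + ε - 2 * τ) (gradSq u)) ≤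
          weightedIntegral ε (a - 2 * τ) (fun x => (Δ u) x ^ 2) ∧
        c * (τ ^ 2 * weightedIntegral ε (a - 2 - 2 * τ) (fun x => u x ^ 2)) ≤
          weightedIntegral ε (a - 2 * τ) (gradSq u))
    (hu : IsTestFunction puncturedDisc u) :
    carlemanControl ε τ u ≤ 10 ^ 8 * M ^ 6 * carlemanSource ε τ u := by
  rw [carlemanControl_eq, carlemanSource_eq]
  have hτ0 : 0 < τ := by linarith
  have hτ1 : 1 ≤ τ := by linarith
  have hS : 0 ≤ weightedIntegral ε (4 - 2 * τ) (fun x => (Δ (Δ (Δ u))) x ^ 2) :=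
    weightedIntegral_nonneg fun x => sq_nonneg _
  have hu1 := hu.laplacian
  have hu2 := hu1.laplacian
  have habs {a : ℝ} (h : -12 ≤ a) (h' : a ≤ 12) : |a| ≤ 12 := abs_le.2 ⟨h, h'⟩
  -- Each shift `a` is the one reached by the preceding inequality: the gradient step takes `a` to
  -- `a - 2 + ε`, the Hardy step to `a - 2`.
  have s1 := (hstep 4 (habs (by norm_num) (by norm_num)) _ hu2).1
  have s2 := (hstep (2 + ε) (habs (by linarith) (by linarith)) _ hu2).2
  have s3 := (hstep ε (habs (by linarith) (by linarith)) _ hu1).1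
  have s4 := (hstep (-2 + 2 * ε) (habs (by linarith) (by linarith)) _ hu1).2
  have s5 := (hstep (-4 + 2 * ε) (habs (by linarith) (by linarith)) _ hu).1
  have s6 := (hstep (-6 + 3 * ε) (habs (by linarith) (by linarith)) _ hu).2
  rw [show 4 - 2 + ε - 2 * τ = 2 + ε - 2 * τ by ring] at s1
  rw [show 2 + ε - 2 - 2 * τ = ε - 2 * τ by ring] at s2
  rw [show ε - 2 + ε - 2 * τ = -2 + 2 * ε - 2 * τ by ring] at s3
  rw [show -2 + 2 * ε - 2 - 2 * τ = -4 + 2 * ε - 2 * τ by ring] at s4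
  rw [show -4 + 2 * ε - 2 + ε - 2 * τ = -6 + 3 * ε - 2 * τ by ring] at s5
  rw [show -6 + 3 * ε - 2 - 2 * τ = -8 + 3 * ε - 2 * τ by ring] at s6
  -- Derivatives of order `k` are estimated with exponent `2k - 8 + 3ε - 2τ` and only then moved to
  -- `5ε`.
  have m0 := weightedIntegral_mono (a := 5 * ε - 8 - 2 * τ) (b := -8 + 3 * ε - 2 * τ) hε hu.sq hu.sq
    (by linarith) (fun x => sq_nonneg _) (fun x => le_rfl)
  have m1 := weightedIntegral_mono (a := 5 * ε - 6 - 2 * τ) (b := -6 + 3 * ε - 2 * τ) hε hu.gradSq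
    hu.gradSq (by linarith) (gradSq_nonneg u) (fun x => le_rfl)
  have m2 := weightedIntegral_mono (a := -4 + 3 * ε - 2 * τ) (b := -4 + 2 * ε - 2 * τ) hε hu1.sq
    hu1.sq (by linarith) (fun x => sq_nonneg _) (fun x => le_rfl)
  have m2' := weightedIntegral_mono (a := 5 * ε - 4 - 2 * τ) (b := -4 + 3 * ε - 2 * τ) hε hu.hessSq
    hu.hessSq (by linarith) (hessSq_nonneg u) (fun x => le_rfl)
  have m3 := weightedIntegral_mono (a := -2 + 3 * ε - 2 * τ) (b := -2 + 2 * ε - 2 * τ) hε hu1.gradSq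
    hu1.gradSq (by linarith) (gradSq_nonneg _) (fun x => le_rfl)
  have m3' := weightedIntegral_mono (a := 5 * ε - 2 - 2 * τ) (b := -2 + 3 * ε - 2 * τ) hε
    (hu.normSqD 3) (hu.normSqD 3) (by linarith) (normSqD_nonneg 3) (fun x => le_rfl)
  have m4 := weightedIntegral_mono (a := 3 * ε - 2 * τ) (b := ε - 2 * τ) hε hu2.sq
    hu2.sq (by linarith) (fun x => sq_nonneg _) (fun x => le_rfl)
  have m4' := weightedIntegral_mono (a := 5 * ε - 2 * τ) (b := 3 * ε - 2 * τ) hε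
    (hu.normSqD 4) (hu.normSqD 4) (by linarith) (normSqD_nonneg 4) (fun x => le_rfl)
  have d2 := weightedIntegral_hessSq_le (b := -4 + 3 * ε - 2 * τ) hε hu
  have d3 := weightedIntegral_normSqD_three_le (b := -2 + 3 * ε - 2 * τ) hε hu
  have d4 := weightedIntegral_normSqD_four_le (b := 3 * ε - 2 * τ) hε hu
  have d5 := weightedIntegral_hessSq_le (b := 3 * ε - 2 * τ) hε hu1
  rw [show -4 + 3 * ε - 2 * τ - 2 = -6 + 3 * ε - 2 * τ by ring] at d2
  rw [show -2 + 3 * ε - 2 * τ - 2 = -4 + 3 * ε - 2 * τ by ring] at d3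
  rw [show 3 * ε - 2 * τ - 2 = -2 + 3 * ε - 2 * τ by ring] at d4 d5
  -- Since `|a| ≤ 12 ≤ τ`, `|a - 2τ| ≤ 3τ`.
  have hb {a : ℝ} (h : -12 ≤ a) (h' : a ≤ 12) : (a - 2 * τ) ^ 2 ≤ 9 * τ ^ 2 := by nlinarith
  have b2 := hb (a := -4 + 3 * ε) (by linarith) (by linarith)
  have b3 := hb (a := -2 + 3 * ε) (by linarith) (by linarith)
  have b4 := hb (a := 3 * ε) (by linarith) (by linarith)
  have n1 : 0 ≤ weightedIntegral ε (-6 + 3 * ε - 2 * τ) (gradSq u) :=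
    weightedIntegral_nonneg (gradSq_nonneg _)
  have n2 : 0 ≤ weightedIntegral ε (-4 + 3 * ε - 2 * τ) (hessSq u) :=
    weightedIntegral_nonneg (hessSq_nonneg _)
  have n3 : 0 ≤ weightedIntegral ε (-2 + 3 * ε - 2 * τ) (normSqD 3 u) :=
    weightedIntegral_nonneg (normSqD_nonneg 3)
  have n4 : 0 ≤ weightedIntegral ε (-2 + 3 * ε - 2 * τ) (gradSq (Δ u)) :=
    weightedIntegral_nonneg (gradSq_nonneg _)
  have n5 : 0 ≤ weightedIntegral ε (-4 + 2 * ε - 2 * τ) (fun x => (Δ u) x ^ 2) :=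
    weightedIntegral_nonneg fun x => sq_nonneg _
  have n6 : 0 ≤ weightedIntegral ε (-2 + 2 * ε - 2 * τ) (gradSq (Δ u)) :=
    weightedIntegral_nonneg (gradSq_nonneg _)
  have n7 : 0 ≤ weightedIntegral ε (ε - 2 * τ) (fun x => (Δ (Δ u)) x ^ 2) :=
    weightedIntegral_nonneg fun x => sq_nonneg _
  generalize weightedIntegral ε (4 - 2 * τ) (fun x => (Δ (Δ (Δ u))) x ^ 2) = S at *
  generalize weightedIntegral ε (2 + ε - 2 * τ) (gradSq (Δ (Δ u))) = X1 at *
  generalize weightedIntegral ε (ε - 2 * τ) (fun x => (Δ (Δ u)) x ^ 2) = X2 at *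
  generalize weightedIntegral ε (-2 + 2 * ε - 2 * τ) (gradSq (Δ u)) = X3 at *
  generalize weightedIntegral ε (-4 + 2 * ε - 2 * τ) (fun x => (Δ u) x ^ 2) = X4 at *
  generalize weightedIntegral ε (-6 + 3 * ε - 2 * τ) (gradSq u) = X5 at *
  generalize weightedIntegral ε (-8 + 3 * ε - 2 * τ) (fun x => u x ^ 2) = X6 at *
  generalize weightedIntegral ε (-4 + 3 * ε - 2 * τ) (fun x => (Δ u) x ^ 2) = Y4 at *
  generalize weightedIntegral ε (-2 + 3 * ε - 2 * τ) (gradSq (Δ u)) = Y3 at *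
  generalize weightedIntegral ε (3 * ε - 2 * τ) (fun x => (Δ (Δ u)) x ^ 2) = Y2 at *
  generalize weightedIntegral ε (3 * ε - 2 * τ) (hessSq (Δ u)) = H at *
  generalize weightedIntegral ε (-4 + 3 * ε - 2 * τ) (hessSq u) = D2 at *
  generalize weightedIntegral ε (-2 + 3 * ε - 2 * τ) (normSqD 3 u) = D3 at *
  generalize weightedIntegral ε (3 * ε - 2 * τ) (normSqD 4 u) = D4 at *
  have p1 : 1 * (τ * X1) ≤ M * 1 * S :=
    le_mul_of_mul_le_of_le hcM hc zero_le_one s1 (by linarith)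
  have p2 : τ * (τ ^ 2 * X2) ≤ M * (M * 1) * S :=
    le_mul_of_mul_le_of_le hcM hc hτ0.le s2 (by linarith)
  have p3 : τ ^ 3 * (τ * X3) ≤ M * (M * (M * 1)) * S :=
    le_mul_of_mul_le_of_le hcM hc (by positivity) s3 (by linarith)
  have p4 : τ ^ 4 * (τ ^ 2 * X4) ≤ M * (M * (M * (M * 1))) * S :=
    le_mul_of_mul_le_of_le hcM hc (by positivity) s4 (by linarith)
  have p5 : τ ^ 6 * (τ * X5) ≤ M * (M * (M * (M * (M * 1)))) * S :=
    le_mul_of_mul_le_of_le hcM hc (by positivity) s5 (by linarith)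
  have p6 : τ ^ 7 * (τ ^ 2 * X6) ≤ M * (M * (M * (M * (M * (M * 1))))) * S :=
    le_mul_of_mul_le_of_le hcM hc (by positivity) s6 (by linarith)
  obtain ⟨T, hT⟩ : ∃ T, T = M ^ 6 * S := ⟨_, rfl⟩
  have hMT (k : ℕ) (hk : k ≤ 6) : M ^ k * S ≤ T := by
    rw [hT]
    exact mul_le_mul_of_nonneg_right (pow_le_pow_right₀ hM hk) hS
  have q1 : τ * X1 ≤ T := by linarith [hMT 1 (by norm_num)]
  have q2 : τ ^ 3 * X2 ≤ T := by linarith [hMT 2 (by norm_num)]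
  have q3 : τ ^ 4 * X3 ≤ T := by linarith [hMT 3 (by norm_num)]
  have q4 : τ ^ 6 * X4 ≤ T := by linarith [hMT 4 (by norm_num)]
  have q5 : τ ^ 7 * X5 ≤ T := by linarith [hMT 5 (by norm_num)]
  have q6 : τ ^ 9 * X6 ≤ T := by linarith [hMT 6 (by norm_num)]
  have r4 : τ ^ 5 * Y4 ≤ T := calc
    τ ^ 5 * Y4 ≤ τ ^ 5 * X4 := by gcongr
    _ ≤ τ ^ 6 * X4 := by gcongr; norm_num
    _ ≤ T := q4
  have r3 : τ ^ 3 * Y3 ≤ T := calc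
    τ ^ 3 * Y3 ≤ τ ^ 3 * X3 := by gcongr
    _ ≤ τ ^ 4 * X3 := by gcongr; norm_num
    _ ≤ T := q3
  have r2 : τ * Y2 ≤ T := calc
    τ * Y2 ≤ τ * X2 := by gcongr
    _ = τ ^ 1 * X2 := by ring
    _ ≤ τ ^ 3 * X2 := by gcongr; norm_num
    _ ≤ T := q2
  -- The constants are `74 = 2 + 8·9`, `10658 = 2 + 144·74` and `767524 = 2·74 + 72·10658`; the sum
  -- over all terms is far below `10 ^ 8`.
  have t2 : τ ^ 5 * D2 ≤ 74 * T := calc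
    τ ^ 5 * D2 ≤ τ ^ 5 * (2 * Y4 + 8 * (9 * τ ^ 2 * X5)) := by
      gcongr
      exact d2.trans (by gcongr)
    _ = 2 * (τ ^ 5 * Y4) + 72 * (τ ^ 7 * X5) := by ring
    _ ≤ 74 * T := by linarith
  have t3 : τ ^ 3 * D3 ≤ 10658 * T := calc
    τ ^ 3 * D3 ≤ τ ^ 3 * (2 * Y3 + 16 * (9 * τ ^ 2 * D2)) := by
      gcongr
      exact d3.trans (by gcongr)
    _ = 2 * (τ ^ 3 * Y3) + 144 * (τ ^ 5 * D2) := by ring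
    _ ≤ 10658 * T := by linarith
  have tH : τ * H ≤ 74 * T := calc
    τ * H ≤ τ * (2 * Y2 + 8 * (9 * τ ^ 2 * Y3)) := by
      gcongr
      exact d5.trans (by gcongr)
    _ = 2 * (τ * Y2) + 72 * (τ ^ 3 * Y3) := by ring
    _ ≤ 74 * T := by linarith
  have t4 : τ * D4 ≤ 767524 * T := calc
    τ * D4 ≤ τ * (2 * H + 8 * (9 * τ ^ 2 * D3)) := by
      gcongr
      exact d4.trans (by gcongr)
    _ = 2 * (τ * H) + 72 * (τ ^ 3 * D3) := by ring
    _ ≤ 767524 * T := by linarith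
  have f0 := mul_le_mul_of_nonneg_left m0 (by positivity : 0 ≤ τ ^ 9)
  have f1 := mul_le_mul_of_nonneg_left m1 (by positivity : 0 ≤ τ ^ 7)
  have f2 := mul_le_mul_of_nonneg_left m2' (by positivity : 0 ≤ τ ^ 5)
  have f3 := mul_le_mul_of_nonneg_left m3' (by positivity : 0 ≤ τ ^ 3)
  have f4 := mul_le_mul_of_nonneg_left m4' hτ0.le
  have hT0 : 0 ≤ T := by rw [hT]; positivity
  calc _ ≤ 10 ^ 8 * T := by linarith
    _ = _ := by rw [hT]; ring

/-- The same descent with the gradient step for the phase containing `r / |x|`: each round gains `r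
τ²` and lowers the exponent by `3 + 2`, so three rounds lead from `4 - 2τ` to `-11 - 2τ`. -/
theorem carlemanExterior_le {ε τ r c M : ℝ} {u : Plane → ℝ} (hτ : 12 ≤ τ) (hc : 0 < c)
    (hcM : M * c = 1) (hr : 0 < r)
    (hstep : ∀ a : ℝ, |a| ≤ 12 → ∀ u, IsTestFunction puncturedDisc u →
        c * (τ ^ 2 * weightedIntegral ε (a - 2 - 2 * τ) (fun x => u x ^ 2)) ≤
          weightedIntegral ε (a - 2 * τ) (gradSq u))
    (hext : ∀ a : ℝ, |a| ≤ 12 → ∀ u,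
      IsTestFunction (Metric.ball 0 1 \ Metric.closedBall 0 (r / 4)) u →
      c * (r * weightedIntegral ε (a - 3 - 2 * τ) (gradSq u)) ≤
        weightedIntegral ε (a - 2 * τ) (fun x => (Δ u) x ^ 2))
    (hu : IsTestFunction (Metric.ball 0 1 \ Metric.closedBall 0 (r / 4)) u) :
    τ ^ 6 * r ^ 3 * ∫ x, rhoWeight ε x ^ (-11 - 2 * τ) * u x ^ 2 ≤
      M ^ 6 * carlemanSource ε τ u := by
  rw [carlemanSource_eq]
  have hsub : Metric.ball 0 1 \ Metric.closedBall (0 : Plane) (r / 4) ⊆ puncturedDisc :=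
    fun x hx => ⟨hx.1, fun h => hx.2 (by rw [Set.mem_singleton_iff.1 h]; simp; positivity)⟩
  have hτ0 : 0 < τ := by linarith
  have hu1 := hu.laplacian
  have hu2 := hu1.laplacian
  have habs {a : ℝ} (h : -12 ≤ a) (h' : a ≤ 12) : |a| ≤ 12 := abs_le.2 ⟨h, h'⟩
  have s1 := hext 4 (habs (by norm_num) (by norm_num)) _ hu2
  have s2 := hstep 1 (habs (by norm_num) (by norm_num)) _ (hu2.mono hsub)
  have s3 := hext (-1) (habs (by norm_num) (by norm_num)) _ hu1
  have s4 := hstep (-4) (habs (by norm_num) (by norm_num)) _ (hu1.mono hsub)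
  have s5 := hext (-6) (habs (by norm_num) (by norm_num)) _ hu
  have s6 := hstep (-9) (habs (by norm_num) (by norm_num)) _ (hu.mono hsub)
  norm_num at s1 s2 s3 s4 s5 s6
  change τ ^ 6 * r ^ 3 * weightedIntegral ε (-11 - 2 * τ) (fun x => u x ^ 2) ≤ _
  generalize weightedIntegral ε (4 - 2 * τ) (fun x => (Δ (Δ (Δ u))) x ^ 2) = S at *
  have p1 := le_mul_of_mul_le_of_le (m := 1) (Z := 1) hcM hc zero_le_one s1 le_rfl
  have p2 := le_mul_of_mul_le_of_le (m := r) (Z := M * 1) (S := S) hcM hc hr.le s2 (by linarith)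
  have p3 := le_mul_of_mul_le_of_le (m := r * τ ^ 2) (Z := M * (M * 1)) (S := S) hcM hc
    (by positivity) s3 (by linarith)
  have p4 := le_mul_of_mul_le_of_le (m := r ^ 2 * τ ^ 2) (Z := M * (M * (M * 1))) (S := S) hcM hc
    (by positivity) s4 (by linarith)
  have p5 := le_mul_of_mul_le_of_le (m := r ^ 2 * τ ^ 4) (Z := M * (M * (M * (M * 1)))) (S := S)
    hcM hc (by positivity) s5 (by linarith)
  have p6 := le_mul_of_mul_le_of_le (m := r ^ 3 * τ ^ 4) (Z := M * (M * (M * (M * (M * 1)))))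
    (S := S) hcM hc (by positivity) s6 (by linarith)
  linarith

theorem proposition4p4 (ε : ℝ) (hε : 0 < ε) (hε' : ε ≤ 1 / 5) :
    ∃ τ₀ C R₁ : ℝ, 1 < τ₀ ∧ 1 < C ∧ 0 < R₁ ∧ R₁ ≤ 1 ∧
      (∀ τ : ℝ, τ₀ ≤ τ →
        ∀ u : Plane → ℝ, IsTestFunction (Metric.ball 0 R₁ \ {0}) u →
          C * carlemanSource ε τ u ≥ carlemanControl ε τ u) ∧
      (∀ τ : ℝ, τ₀ ≤ τ → ∀ r : ℝ, 0 < r → r < R₁ →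
        ∀ u : Plane → ℝ,
          IsTestFunction (Metric.ball 0 R₁ \ Metric.closedBall 0 (r / 4)) u →
            C * carlemanSource ε τ u ≥
              carlemanControl ε τ u +
                τ ^ 6 * r ^ 3 * ∫ x, rhoWeight ε x ^ (-11 - 2 * τ) * u x ^ 2) := by
  obtain ⟨c, hc, hc1, hstep, hext⟩ := exists_carleman_constant hε
  have hcM : c⁻¹ * c = 1 := inv_mul_cancel₀ hc.ne'
  have hM : 1 ≤ c⁻¹ := (one_le_inv₀ hc).2 hc1
  have hM6 : 1 ≤ c⁻¹ ^ 6 := one_le_pow₀ hM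
  have hS (τ : ℝ) (u : Plane → ℝ) : 0 ≤ carlemanSource ε τ u := by
    rw [carlemanSource_eq]
    exact weightedIntegral_nonneg fun x => sq_nonneg _
  -- The radius is `1`, where `ρ ≤ |x| ≤ 1`. In the constant, `10 ^ 8` serves the control terms and
  -- the extra `1` the exterior term.
  refine ⟨12, (10 ^ 8 + 1) * c⁻¹ ^ 6, 1, by norm_num, by linarith, one_pos, le_rfl,
    fun τ hτ u hu => ?_, fun τ hτ r hr _ u hu => ?_⟩
  · have h := carlemanControl_le hε hε' hτ hc hcM hM (fun a ha => hstep τ a hτ ha) hu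
    have h' : 0 ≤ c⁻¹ ^ 6 * carlemanSource ε τ u := mul_nonneg (by positivity) (hS τ u)
    linarith
  · have hsub : Metric.ball 0 1 \ Metric.closedBall (0 : Plane) (r / 4) ⊆ puncturedDisc :=
      fun x hx => ⟨hx.1, fun h => hx.2 (by rw [Set.mem_singleton_iff.1 h]; simp; positivity)⟩
    have h := carlemanControl_le hε hε' hτ hc hcM hM (fun a ha => hstep τ a hτ ha) (hu.mono hsub)
    have h' := carlemanExterior_le hτ hc hcM hr (fun a ha v hv => (hstep τ a hτ ha v hv).2)
      (fun a ha => hext τ a r hτ ha hr) hu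
    linarith
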